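/- Fix constants $0<\rho\le v_{\max}$. In each round $t=1,\dots,T$ a buyer with total budget $B=\rho T$ sees a value $v_t\in[0,v_{\max}]$ and decides $x_t\in\{0,1\}$ (enter or not) in a second-price auction with highest competing bid $p_t\in[0,v_{\max}]$. Entering yields revenue $r_t=(v_t-p_t)^+$ and cost $c_t=p_t\mathbf 1[v_t\ge p_t]$. The values $\bm v=(v_t)_{t\le T}$ are arbitrary (adversarial, fixed in advance), and $\bm p=(p_t)_{t\le T}$ is drawn i.i.d. from an unknown distribution $G$ on $[0,v_{\max}]$. Feedback is partial: $p_t$ is observed at the end of round $t$ only if $x_t=1$. The OGD-CB algorithm starts with $\mathcal I_1=\emptyset$, $B_1=B$, $\lambda_1=0$. In round $1$ it sets $x_1=1$ and $\lambda_2=\lambda_1$. In a round $t\ge 2$ it sets $$\epsilon_t=\sqrt{\frac{\ln 2+2\ln T}{2|\mathcal I_t|}},\quad \tilde r_t=\frac1{|\mathcal I_t|}\sum_{\tau\in\mathcal I_t}(v_t-p_\tau)^+ +\epsilon_t v_t,\quad \tilde c_t=\frac1{|\mathcal I_t|}\sum_{\tau\in\mathcal I_t}p_\tau\mathbf 1[v_t\ge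 p_\tau]-2\epsilon_t v_t,$$ $$x_t=\mathbf 1[\tilde r_t\ge\lambda_t\tilde c_t],\qquad \lambda_{t+1}=\Bigl(\lambda_t+\frac{1}{v_{\max}\sqrt t}\,(x_t\tilde c_t-\rho)\Bigr)^+.$$ In every round, $\mathcal I_{t+1}=\mathcal I_t\cup\{t\}$ if $x_t=1$ and $\mathcal I_{t+1}=\mathcal I_t$ otherwise, and $B_{t+1}=B_t-x_tc_t$; the algorithm stops (that is, $x_s=0$ for all $s>t$) as soon as $B_{t+1}<v_{\max}$. Let $U_T(\bm v,\bm p)=\sum_{t=1}^T x_t r_t$ be its total revenue, and let $$H_T(\bm v,\bm p)=\max_{\bm y\in\{0,1\}^T}\ \sum_{t=1}^T y_t(v_t-p_t)^+\quad\text{s.t.}\quad \sum_{t=1}^T y_t\,p_t\mathbf 1[v_t\ge p_t]\le \rho T$$ be the hindsight benchmark. **Theorem.** For all $T$, $\bm v\in[0,v_{\max}]^T$ and $G$, both $U_T(\bm v,\cdot)$ and $H_T(\bm v,\cdot)$ are integrable with respect to $G^T$, and OGD-CB with partial feedback is asymptotically $(\rho/v_{\max})$-competitive: $$\liminf_{T\to\infty}\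 \inf_{\bm v\in[0,v_{\max}]^T,\ G}\ \frac1T\,\mathbb E_{\bm p\sim G^T}\Bigl[U_T(\bm v,\bm p)-\frac{\rho}{v_{\max}}\,H_T(\bm v,\bm p)\Bigr]\ \ge\ 0 .$$ -/

import Mathlib

open MeasureTheory Filter

/-! Repeated second-price auctions with a budget, and the throttling algorithm OGD-CB with
partial information feedback. Rounds are numbered `1, …, T`; `v t` is the buyer's value and
`p t` the highest competing bid in round `t`. -/

namespace Throttling

/-- Revenue `(v - p)⁺` of entering an auction with value `v` against the competing bid `p`. -/
noncomputable def reward (v p : ℝ) : ℝ := max (v - p) 0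

/-- Cost `p · 𝟏[v ≥ p]` of entering an auction with value `v` against the competing bid `p`. -/
noncomputable def cost (v p : ℝ) : ℝ := if p ≤ v then p else 0

/-- A vector `(w_1, …, w_T)` with entries in `[0, vmax]`, read as a sequence indexed by the
rounds: round `t` with `1 ≤ t ≤ T` has the value `w_t`. Other indices are never rounds. -/
noncomputable def rounds {vmax : ℝ} {T : ℕ} (w : Fin T → Set.Icc (0 : ℝ) vmax) (t : ℕ) : ℝ :=
  if h : 1 ≤ t ∧ t ≤ T then (w ⟨t - 1, by omega⟩ : ℝ) else 0

/-- What OGD-CB stores at the start of a round. -/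
structure State where
  /-- `false` once the algorithm has left its loop -/
  active : Bool
  /-- the set `𝓘_t` of earlier rounds whose competing bid was observed -/
  observed : Finset ℕ
  /-- the pricing variable `λ_t` -/
  lam : ℝ
  /-- the remaining budget `B_t` -/
  budget : ℝ

/-- The state at the start of round `1`; the total budget is `B = ρ T`. -/
noncomputable def State.init (ρ : ℝ) (T : ℕ) : State where
  active := true
  observed := ∅
  lam := 0
  budget := ρ * T

/-- The confidence radius `ε_t = √((ln 2 + 2 ln T) / (2 |𝓘_t|))`. -/
noncomputable def radius (T : ℕ) (s : State) : ℝ :=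
  Real.sqrt ((Real.log 2 + 2 * Real.log T) / (2 * (s.observed.card : ℝ)))

/-- The optimistic estimate of the expected revenue at value `w`. -/
noncomputable def estReward (T : ℕ) (p : ℕ → ℝ) (s : State) (w : ℝ) : ℝ :=
  (∑ τ ∈ s.observed, reward w (p τ)) / (s.observed.card : ℝ) + radius T s * w

/-- The optimistic estimate of the expected cost at value `w`. -/
noncomputable def estCost (T : ℕ) (p : ℕ → ℝ) (s : State) (w : ℝ) : ℝ :=
  (∑ τ ∈ s.observed, cost w (p τ)) / (s.observed.card : ℝ) - 2 * radius T s * w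

/-- The decision `x_t ∈ {0, 1}` in round `t`: enter in round `1`; later, enter iff the estimated
revenue is at least `λ_t` times the estimated cost; never enter after the loop was left. -/
noncomputable def action (T : ℕ) (v p : ℕ → ℝ) (t : ℕ) (s : State) : ℝ :=
  if s.active = true ∧ (t = 1 ∨ s.lam * estCost T p s (v t) ≤ estReward T p s (v t)) then 1 else 0

/-- The step size `η_t = 1 / (vmax √t)`. -/
noncomputable def stepSize (vmax : ℝ) (t : ℕ) : ℝ := 1 / (vmax * Real.sqrt t)

/-- One round of OGD-CB with partial information feedback: `p t` is recorded only if the buyer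
enters, and the loop is left when the remaining budget falls below `vmax`. -/
noncomputable def step (vmax ρ : ℝ) (T : ℕ) (v p : ℕ → ℝ) (t : ℕ) (s : State) : State :=
  if s.active = true then
    { active := decide (vmax ≤ s.budget - action T v p t s * cost (v t) (p t))
      observed := if action T v p t s = 1 then insert t s.observed else s.observed
      lam := if t = 1 then s.lam else
        max (s.lam + stepSize vmax t * (action T v p t s * estCost T p s (v t) - ρ)) 0
      budget := s.budget - action T v p t s * cost (v t) (p t) }
  else s

/-- The state of OGD-CB after round `t` (that is, at the start of round `t + 1`). -/
noncomputable def stateAfter (vmax ρ : ℝ) (T : ℕ) (v p : ℕ → ℝ) : ℕ → State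
  | 0 => State.init ρ T
  | t + 1 => step vmax ρ T v p (t + 1) (stateAfter vmax ρ T v p t)

/-- The total revenue `∑_{t ≤ T} x_t r_t` of OGD-CB with partial information feedback, average
budget `ρ` and horizon `T` (decisions after the last entered round contribute `0`). -/
noncomputable def algRevenue (vmax ρ : ℝ) (T : ℕ) (v p : ℕ → ℝ) : ℝ :=
  ∑ t ∈ Finset.Icc 1 T,
    action T v p t (stateAfter vmax ρ T v p (t - 1)) * reward (v t) (p t)

/-- The revenues of all entering decisions (given as the set `S` of entered rounds) whose total
cost is at most `T ρ`. -/
def feasibleRevenues (ρ : ℝ) (T : ℕ) (v p : ℕ → ℝ) : Set ℝ :=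
  {R | ∃ S ⊆ Finset.Icc 1 T, ∑ t ∈ S, cost (v t) (p t) ≤ T * ρ ∧
    R = ∑ t ∈ S, reward (v t) (p t)}

/-- The hindsight benchmark: the largest revenue within the budget when all of `v` and `p` are
known beforehand. -/
noncomputable def hindsight (ρ : ℝ) (T : ℕ) (v p : ℕ → ℝ) : ℝ :=
  sSup (feasibleRevenues ρ T v p)

/-- The supremum in the hindsight benchmark is a maximum. -/
theorem hindsight_isGreatest {ρ : ℝ} (hρ : 0 ≤ ρ) (T : ℕ) (v p : ℕ → ℝ) :
    IsGreatest (feasibleRevenues ρ T v p) (hindsight ρ T v p) := by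
  have hfin : (feasibleRevenues ρ T v p).Finite := by
    refine (((Finset.Icc 1 T).powerset : Finset (Finset ℕ)).finite_toSet.image
      (fun S => ∑ t ∈ S, reward (v t) (p t))).subset ?_
    rintro R ⟨S, hS, -, rfl⟩
    exact ⟨S, Finset.mem_coe.2 (Finset.mem_powerset.2 hS), rfl⟩
  have hne : (feasibleRevenues ρ T v p).Nonempty :=
    ⟨0, ∅, by simp, by simpa using mul_nonneg (Nat.cast_nonneg T) hρ, by simp⟩
  exact ⟨hne.csSup_mem hfin, fun _ h => le_csSup hfin.bddAbove h⟩

end Throttling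

namespace Throttling

/-! Write `α = ρ / vmax`, and let `rbar t`, `cbar t` be the mean revenue and mean cost of entering
with value `v t`. Dropping the budget constraint bounds the expected benchmark by `∑ rbar t`
(`integral_hindsight_le`), so the algorithm only has to earn `α ∑ rbar t` up to `o(T)`.

The source of `α`: entering with probability `α` in every round costs at most `α * vmax = ρ` per
round and earns the fraction `α` of the revenue. The threshold rule maximises the estimated
Lagrangian of each round, hence does at least as well as this mixture for the current `λ`. Since `λ`
follows projected gradient descent, the Lagrangian terms can be compared with those of a fixed
multiplier `u`. If the budget lasts, `u = 0` gives the claim. If the algorithm stops early, `u = 1`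
does: almost all of `ρ T` has been spent, and each later round loses at most `α * rbar ≤ ρ`, which
its unspent allowance `ρ` pays for (`primal_dual_round`, `primal_dual_sum`, `pathwise_revenue`).

Partial feedback costs nothing essential, because every confidence radius that is paid for belongs
to a round that is entered and so adds an observation: the sum of `1 / √N` over these rounds is
`O(√T)`. What remains is probabilistic. Each decision uses earlier bids only, so revenue has the
same expectation as its conditional mean (`integral_algRevenue`), cost noise is a martingale of size
`√T` (`integral_abs_costNoise_le`), and errors beyond the radius have total expectation `O(1)` by an
exponential supermartingale (`integral_excess_le`). The resulting loss `O(√T log T)` is uniform in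
the values and in `G`, so it survives the infimum. -/

/-! ### Elementary bounds, bookkeeping of the state, boundedness of the multiplier. -/

theorem reward_nonneg (w p : ℝ) : 0 ≤ reward w p := le_max_right _ _

theorem reward_le {w p : ℝ} (hw : 0 ≤ w) (hp : 0 ≤ p) : reward w p ≤ w :=
  max_le (by linarith) hw

theorem cost_nonneg {w p : ℝ} (hp : 0 ≤ p) : 0 ≤ cost w p := by
  unfold cost; split_ifs <;> simp [hp]

theorem cost_le {w p : ℝ} (hw : 0 ≤ w) : cost w p ≤ w := by
  unfold cost; split_ifs <;> assumption

theorem average_nonneg {S : Finset ℕ} {f : ℕ → ℝ} (h0 : ∀ i ∈ S, 0 ≤ f i) :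
    0 ≤ (∑ i ∈ S, f i) / (S.card : ℝ) :=
  div_nonneg (Finset.sum_nonneg h0) (Nat.cast_nonneg _)

theorem average_le {S : Finset ℕ} {f : ℕ → ℝ} {w : ℝ} (hw : 0 ≤ w) (h : ∀ i ∈ S, f i ≤ w) :
    (∑ i ∈ S, f i) / (S.card : ℝ) ≤ w := by
  refine div_le_of_le_mul₀ (Nat.cast_nonneg _) hw ?_
  have := Finset.sum_le_card_nsmul S f w h
  rw [nsmul_eq_mul] at this
  linarith

theorem action_eq (T : ℕ) (v p : ℕ → ℝ) (t : ℕ) (s : State) :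
    action T v p t s = 0 ∨ action T v p t s = 1 := by
  unfold action; split_ifs <;> simp

theorem action_nonneg (T : ℕ) (v p : ℕ → ℝ) (t : ℕ) (s : State) : 0 ≤ action T v p t s := by
  rcases action_eq T v p t s with h | h <;> simp [h]

theorem action_le_one (T : ℕ) (v p : ℕ → ℝ) (t : ℕ) (s : State) : action T v p t s ≤ 1 := by
  rcases action_eq T v p t s with h | h <;> simp [h]

theorem action_of_inactive {T : ℕ} {v p : ℕ → ℝ} {t : ℕ} {s : State} (h : s.active ≠ true) :
    action T v p t s = 0 := by
  simp [action, h]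

theorem step_of_inactive {vmax ρ : ℝ} {T : ℕ} {v p : ℕ → ℝ} {t : ℕ} {s : State}
    (h : s.active ≠ true) : step vmax ρ T v p t s = s := by
  simp [step, h]

theorem observed_step (vmax ρ : ℝ) (T : ℕ) (v p : ℕ → ℝ) (t : ℕ) (s : State) :
    (step vmax ρ T v p t s).observed =
      if action T v p t s = 1 then insert t s.observed else s.observed := by
  by_cases h : s.active = true
  · simp [step, h]
  · simp [step_of_inactive h, action_of_inactive h]

theorem budget_step (vmax ρ : ℝ) (T : ℕ) (v p : ℕ → ℝ) (t : ℕ) (s : State) :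
    (step vmax ρ T v p t s).budget = s.budget - action T v p t s * cost (v t) (p t) := by
  by_cases h : s.active = true
  · simp [step, h]
  · simp [step_of_inactive h, action_of_inactive h]

theorem lam_step {vmax ρ : ℝ} {T : ℕ} {v p : ℕ → ℝ} {t : ℕ} {s : State} (h : s.active = true)
    (ht : t ≠ 1) : (step vmax ρ T v p t s).lam =
      max (s.lam + stepSize vmax t * (action T v p t s * estCost T p s (v t) - ρ)) 0 := by
  simp [step, h, ht]

theorem active_of_step {vmax ρ : ℝ} {T : ℕ} {v p : ℕ → ℝ} {t : ℕ} {s : State}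
    (h : (step vmax ρ T v p t s).active = true) : s.active = true := by
  by_contra h'
  rw [step_of_inactive h'] at h
  exact h' h

theorem observed_subset (vmax ρ : ℝ) (T : ℕ) (v p : ℕ → ℝ) (t : ℕ) :
    (stateAfter vmax ρ T v p t).observed ⊆ Finset.Icc 1 t := by
  induction t with
  | zero => simp [stateAfter, State.init]
  | succ t ih =>
    have h : Finset.Icc 1 t ⊆ Finset.Icc 1 (t + 1) := Finset.Icc_subset_Icc_right (by omega)
    rw [stateAfter, observed_step]
    split_ifs
    · exact Finset.insert_subset (by simp) (ih.trans h)
    · exact ih.trans h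

theorem succ_notMem_observed (vmax ρ : ℝ) (T : ℕ) (v p : ℕ → ℝ) (t : ℕ) :
    t + 1 ∉ (stateAfter vmax ρ T v p t).observed := fun h => by
  have := observed_subset vmax ρ T v p t h
  simp at this

theorem card_observed_le (vmax ρ : ℝ) (T : ℕ) (v p : ℕ → ℝ) (t : ℕ) :
    (stateAfter vmax ρ T v p t).observed.card ≤ t := by
  simpa using Finset.card_le_card (observed_subset vmax ρ T v p t)

theorem card_observed_succ (vmax ρ : ℝ) (T : ℕ) (v p : ℕ → ℝ) (t : ℕ) :
    ((stateAfter vmax ρ T v p (t + 1)).observed.card : ℝ) =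
      (stateAfter vmax ρ T v p t).observed.card +
        action T v p (t + 1) (stateAfter vmax ρ T v p t) := by
  rw [stateAfter, observed_step]
  rcases action_eq T v p (t + 1) (stateAfter vmax ρ T v p t) with h | h
  · simp [h]
  · simp [h, Finset.card_insert_of_notMem (succ_notMem_observed vmax ρ T v p t)]

theorem one_le_card_observed (vmax ρ : ℝ) (T : ℕ) (v p : ℕ → ℝ) (t : ℕ) :
    (1 : ℝ) ≤ (stateAfter vmax ρ T v p (t + 1)).observed.card := by
  induction t with
  | zero =>
    rw [card_observed_succ]
    simp [stateAfter, State.init, action]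
  | succ t ih =>
    rw [card_observed_succ]
    linarith [action_nonneg T v p (t + 1 + 1) (stateAfter vmax ρ T v p (t + 1))]

theorem budget_eq (vmax ρ : ℝ) (T : ℕ) (v p : ℕ → ℝ) (t : ℕ) :
    (stateAfter vmax ρ T v p t).budget = ρ * T - ∑ s ∈ Finset.Icc 1 t,
      action T v p s (stateAfter vmax ρ T v p (s - 1)) * cost (v s) (p s) := by
  induction t with
  | zero => simp [stateAfter, State.init]
  | succ t ih =>
    rw [stateAfter, budget_step, ih, Finset.sum_Icc_succ_top (by omega), Nat.add_sub_cancel]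
    ring

theorem budget_lt_of_inactive (vmax ρ : ℝ) (T : ℕ) (v p : ℕ → ℝ) (t : ℕ)
    (h : (stateAfter vmax ρ T v p t).active ≠ true) :
    (stateAfter vmax ρ T v p t).budget < vmax := by
  induction t with
  | zero => simp [stateAfter, State.init] at h
  | succ t ih =>
    by_cases h' : (stateAfter vmax ρ T v p t).active = true
    · rw [stateAfter] at h ⊢
      rw [budget_step]
      simpa [step, h'] using h
    · rw [stateAfter, step_of_inactive h']
      exact ih h'

theorem radius_nonneg (T : ℕ) (s : State) : 0 ≤ radius T s := Real.sqrt_nonneg _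

theorem estCost_le {T : ℕ} {p : ℕ → ℝ} {s : State} {w : ℝ} (hw : 0 ≤ w) :
    estCost T p s w ≤ w := by
  have h1 := average_le (S := s.observed) (f := fun τ => cost w (p τ)) hw fun i _ => cost_le hw
  have h2 := mul_nonneg (radius_nonneg T s) hw
  unfold estCost
  linarith

section Pathwise

variable {vmax ρ : ℝ} {T : ℕ} {v p : ℕ → ℝ}

theorem lam_nonneg (t : ℕ) : 0 ≤ (stateAfter vmax ρ T v p t).lam := by
  induction t with
  | zero => simp [stateAfter, State.init]
  | succ t ih =>
    rw [stateAfter]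
    by_cases h : (stateAfter vmax ρ T v p t).active = true
    · by_cases ht : t + 1 = 1
      · simpa [step, h, ht] using ih
      · rw [lam_step h ht]
        exact le_max_right _ _
    · rwa [step_of_inactive h]

/-- The multiplier grows only in an entered round with estimated cost above `ρ`. The entering rule
then forces `λ ≤ 2 * vmax / ρ` beforehand, and a single update adds at most `1`. -/
theorem lam_le (hρ : 0 < ρ) (hρv : ρ ≤ vmax) (hv : ∀ t, v t ∈ Set.Icc 0 vmax) (hp : ∀ t, 0 ≤ p t)
    (t : ℕ) : (stateAfter vmax ρ T v p t).lam ≤ 2 * vmax / ρ + 1 := by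
  have hvm : 0 < vmax := hρ.trans_le hρv
  have hΛ : 0 ≤ 2 * vmax / ρ := by positivity
  induction t with
  | zero => simp [stateAfter, State.init]; linarith
  | succ t ih =>
    rw [stateAfter]
    set s := stateAfter vmax ρ T v p t
    by_cases h : s.active = true
    swap
    · rwa [step_of_inactive h]
    by_cases ht : t + 1 = 1
    · simpa [step, h, ht] using ih
    rw [lam_step h ht]
    refine max_le ?_ (by linarith)
    have hη : 0 ≤ stepSize vmax (t + 1) := by unfold stepSize; positivity
    by_cases hg : action T v p (t + 1) s * estCost T p s (v (t + 1)) ≤ ρ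
    · have := mul_nonneg hη (sub_nonneg.2 hg)
      linarith
    push Not at hg
    have hx : action T v p (t + 1) s = 1 := by
      rcases action_eq T v p (t + 1) s with h0 | h0
      · rw [h0, zero_mul] at hg; linarith
      · exact h0
    rw [hx, one_mul] at hg ⊢
    have hdec : s.lam * estCost T p s (v (t + 1)) ≤ estReward T p s (v (t + 1)) := by
      by_contra hc
      simp only [action, hc, ht, or_self, and_false, if_false, zero_ne_one] at hx
    obtain ⟨hw0, hw1⟩ := hv (t + 1)
    have hc := average_le (S := s.observed) (f := fun τ => cost (v (t + 1)) (p τ)) hw0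
      fun i _ => cost_le hw0
    have hr := average_le (S := s.observed) (f := fun τ => reward (v (t + 1)) (p τ)) hw0
      fun i _ => reward_le hw0 (hp i)
    -- The bonus in `estReward` is under control here: an estimated cost above `ρ > 0` leaves `2 *
    -- radius * w` below the empirical cost, hence below `vmax`.
    have hlam : s.lam ≤ 2 * vmax / ρ := by
      rw [le_div_iff₀ hρ]
      have h1 := mul_le_mul_of_nonneg_left hg.le (lam_nonneg t : 0 ≤ s.lam)
      have h2 : 0 < estCost T p s (v (t + 1)) := hρ.trans hg
      unfold estCost estReward at *
      linarith
    have hstep : stepSize vmax (t + 1) * (estCost T p s (v (t + 1)) - ρ) ≤ 1 := by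
      have h1 : estCost T p s (v (t + 1)) - ρ ≤ vmax := by 
        linarith [estCost_le (T := T) (p := p) (s := s) hw0]
      have h3 : (1 : ℝ) ≤ Real.sqrt ((t + 1 : ℕ) : ℝ) := by
        rw [Real.one_le_sqrt]; exact_mod_cast Nat.le_add_left 1 t
      calc _ ≤ stepSize vmax (t + 1) * vmax := mul_le_mul_of_nonneg_left h1 hη
        _ = 1 / Real.sqrt ((t + 1 : ℕ) : ℝ) := by unfold stepSize; field_simp
        _ ≤ 1 := by rw [div_le_one (by linarith)]; exact h3
    linarith

end Pathwise

/-! ### Pathwise primal-dual analysis of gradient descent. -/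

/-- The amount by which the error of the empirical mean of `f` over the observed bids, as an
estimate of `μ`, exceeds the confidence radius at scale `w`. -/
noncomputable def excess (T : ℕ) (p : ℕ → ℝ) (s : State) (f : ℝ → ℝ) (w μ : ℝ) : ℝ :=
  max (|(∑ τ ∈ s.observed, f (p τ)) / (s.observed.card : ℝ) - μ| - radius T s * w) 0

theorem excess_nonneg (T : ℕ) (p : ℕ → ℝ) (s : State) (f : ℝ → ℝ) (w μ : ℝ) :
    0 ≤ excess T p s f w μ := le_max_right _ _

theorem abs_average_sub_le (T : ℕ) (p : ℕ → ℝ) (s : State) (f : ℝ → ℝ) (w μ : ℝ) :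
    |(∑ τ ∈ s.observed, f (p τ)) / (s.observed.card : ℝ) - μ| ≤
      radius T s * w + excess T p s f w μ := by
  have := le_max_left
    (|(∑ τ ∈ s.observed, f (p τ)) / (s.observed.card : ℝ) - μ| - radius T s * w) 0
  unfold excess
  linarith

theorem excess_le {T : ℕ} {p : ℕ → ℝ} {s : State} {f : ℝ → ℝ} {w μ : ℝ} (hw : 0 ≤ w)
    (hf : ∀ i, f (p i) ∈ Set.Icc 0 w) (hμ : μ ∈ Set.Icc 0 w) : excess T p s f w μ ≤ w := by
  refine max_le ?_ hw
  have h1 := average_le (S := s.observed) (f := fun τ => f (p τ)) hw fun i _ => (hf i).2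
  have h2 := average_nonneg (S := s.observed) (f := fun τ => f (p τ)) fun i _ => (hf i).1
  have h3 := mul_nonneg (radius_nonneg T s) hw
  have h4 := abs_sub_le_of_nonneg_of_le h2 h1 hμ.1 hμ.2
  linarith

/-- The squared radius at one observation. -/
noncomputable def radiusSq (T : ℕ) : ℝ := (Real.log 2 + 2 * Real.log T) / 2

theorem radiusSq_nonneg (T : ℕ) : 0 ≤ radiusSq T := by
  have h1 := Real.log_nonneg (by norm_num : (1 : ℝ) ≤ 2)
  have h2 := Real.log_natCast_nonneg T
  unfold radiusSq
  linarith

theorem radius_eq (T : ℕ) (s : State) :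
    radius T s = Real.sqrt (radiusSq T) / Real.sqrt (s.observed.card : ℝ) := by
  rw [radius, ← Real.sqrt_div (radiusSq_nonneg T), radiusSq, div_div]

/-- One step of projected gradient descent towards the comparator `u ≥ 0`. -/
theorem sq_max_sub_le {a u : ℝ} (hu : 0 ≤ u) : (max a 0 - u) ^ 2 ≤ (a - u) ^ 2 := by
  rcases le_total 0 a with h | h
  · rw [max_eq_left h]
  · rw [max_eq_right h]; nlinarith

/-- Makes sums of `1 / √N` telescope when `N` is the count before the increment; `√(x + 1) ≤ 2 * √x`
accounts for the constant `3`. -/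
theorem inv_sqrt_le {x : ℝ} (hx : 1 ≤ x) : 1 / √x ≤ 3 * √(x + 1) - 3 * √x := by
  have h0 : 0 < √x := Real.sqrt_pos.2 (by linarith)
  have h1 : √x ^ 2 = x := Real.sq_sqrt (by linarith)
  have h2 : √(x + 1) ^ 2 = x + 1 := Real.sq_sqrt (by linarith)
  have h3 : √(x + 1) ≤ 2 * √x := by
    rw [Real.sqrt_le_left (by linarith)]
    nlinarith
  rw [div_le_iff₀ h0]
  nlinarith [Real.sqrt_nonneg (x + 1)]

theorem inv_sqrt_succ_le {x : ℝ} (hx : 0 ≤ x) : 1 / √(x + 1) ≤ 3 * √(x + 1) - 3 * √x := by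
  have h0 : 0 < √(x + 1) := Real.sqrt_pos.2 (by linarith)
  have h1 : √x ^ 2 = x := Real.sq_sqrt (by linarith)
  have h2 : √(x + 1) ^ 2 = x + 1 := Real.sq_sqrt (by linarith)
  have h3 : √x ≤ √(x + 1) := Real.sqrt_le_sqrt (by linarith)
  rw [div_le_iff₀ h0]
  nlinarith [Real.sqrt_nonneg x]

/-- The gradient is not uniformly bounded, as the radius `ε` may be large. Its square is `O(1 + x *
ε ^ 2)`, and the radius part, present only in entered rounds, is charged to `x * b`, where `b` will
be `1 / √N`. -/
theorem sq_gradient_le {vmax ρ w x ε c a b : ℝ} (hρ : 0 < ρ) (hρv : ρ ≤ vmax)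
    (hw : w ∈ Set.Icc 0 vmax) (hε : 0 ≤ ε) (ha : 0 ≤ a) (hc : c ∈ Set.Icc 0 w)
    (hx : x = 1 ∨ x = 0) {K : ℝ} (hεsq : ε ^ 2 * a ≤ K * b) :
    (x * (c - 2 * ε * w) - ρ) ^ 2 / vmax * a / 2 ≤ 4 * vmax * a + 4 * vmax * K * (x * b) := by
  have hvm : 0 < vmax := hρ.trans_le hρv
  obtain ⟨hw0, hw1⟩ := hw
  have hx0 : 0 ≤ x := by rcases hx with rfl | rfl <;> norm_num
  have h1 : (x * (c - 2 * ε * w) - ρ) ^ 2 ≤ 8 * vmax ^ 2 * (1 + x * ε ^ 2) := by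
    rcases hx with rfl | rfl
    · have h2 : 1 * (c - 2 * ε * w) - ρ ≤ 2 * vmax * (1 + ε) := by
        have := hc.2
        have : 0 ≤ ε * w := by positivity
        have : 0 ≤ vmax * ε := by positivity
        linarith
      have h3 : -(2 * vmax * (1 + ε)) ≤ 1 * (c - 2 * ε * w) - ρ := by
        have := hc.1
        have : ε * w ≤ ε * vmax := mul_le_mul_of_nonneg_left hw1 hε
        linarith
      have h5 : (1 + ε) ^ 2 ≤ 2 * (1 + ε ^ 2) := by linarith [sq_nonneg (1 - ε)]
      have h6 := mul_le_mul_of_nonneg_left h5 (by positivity : 0 ≤ 4 * vmax ^ 2)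
      linarith [sq_le_sq' h3 h2]
    · have := pow_le_pow_left₀ hρ.le hρv 2
      linarith [sq_nonneg vmax]
  have h2 : (x * (c - 2 * ε * w) - ρ) ^ 2 / vmax ≤ 8 * vmax * (1 + x * ε ^ 2) := by
    rw [div_le_iff₀ hvm]; linarith
  have h3 := mul_le_mul_of_nonneg_right h2 ha
  have h4 := mul_le_mul_of_nonneg_left hεsq hx0
  have h5 := mul_le_mul_of_nonneg_left h4 (by positivity : 0 ≤ 4 * vmax)
  linarith

/-- Revenue, cost and dual progress of one round, with the estimates replaced by true means. -/
theorem primal_dual_round {vmax ρ w x K N y lam u r c rbar cbar er ec cst : ℝ}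
    (hρ : 0 < ρ) (hρv : ρ ≤ vmax) (hw : w ∈ Set.Icc 0 vmax) (hK : 0 ≤ K) (hN : 1 ≤ N)
    (hy : 1 ≤ y) (hlam : 0 ≤ lam) (hu : u = 0 ∨ u = 1) (hc : c ∈ Set.Icc 0 w)
    (hx : x = 1 ∧ lam * (c - 2 * (√K / √N) * w) ≤ r + √K / √N * w ∨
      x = 0 ∧ r + √K / √N * w < lam * (c - 2 * (√K / √N) * w))
    (her : |r - rbar| ≤ √K / √N * w + er) (hec : |c - cbar| ≤ √K / √N * w + ec)
    (her0 : 0 ≤ er) (hec0 : 0 ≤ ec) :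
    vmax * √y / 2 * ((max (lam + 1 / (vmax * √y) * (x * (c - 2 * (√K / √N) * w) - ρ)) 0 - u) ^ 2
        - (lam - u) ^ 2) ≤
      x * rbar - ρ / vmax * rbar + u * (ρ - x * cst) + u * (x * (cst - cbar)) + (2 * er + ec)
        + 9 * vmax * (1 + K) * (x * (1 / √N)) + 4 * vmax * (1 / √y) := by
  have hvm : 0 < vmax := hρ.trans_le hρv
  obtain ⟨hw0, hw1⟩ := hw
  have hsN : 1 ≤ √N := Real.one_le_sqrt.2 hN
  have hsy : 1 ≤ √y := Real.one_le_sqrt.2 hy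
  have hN0 : 0 < √N := by linarith
  have hy0 : 0 < √y := by linarith
  have hu0 : 0 ≤ u := by rcases hu with rfl | rfl <;> norm_num
  have hu1 : u ≤ 1 := by rcases hu with rfl | rfl <;> norm_num
  have hx0 : 0 ≤ x := by rcases hx with ⟨rfl, -⟩ | ⟨rfl, -⟩ <;> norm_num
  have hx1 : x ≤ 1 := by rcases hx with ⟨rfl, -⟩ | ⟨rfl, -⟩ <;> norm_num
  have hα0 : 0 < ρ / vmax := by positivity
  have hα1 : ρ / vmax ≤ 1 := (div_le_one hvm).2 hρv
  set α := ρ / vmax with hα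
  have hαv : α * vmax = ρ := by rw [hα]; field_simp
  set ε := √K / √N with hε
  have hε0 : 0 ≤ ε := by positivity
  have hεK : ε ≤ (1 + K) * (1 / √N) := by
    rw [hε, div_eq_mul_one_div]
    gcongr
    rw [Real.sqrt_le_left (by linarith)]
    nlinarith
  have hεsq : ε ^ 2 * (1 / √y) ≤ K * (1 / √N) := by
    have h1 : ε ^ 2 = K * (1 / √N) * (1 / √N) := by
      rw [hε, div_pow, Real.sq_sqrt hK]; field_simp
    have h2 : 1 / √N ≤ 1 := (div_le_one hN0).2 hsN
    have h3 : 1 / √y ≤ 1 := (div_le_one hy0).2 hsy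
    have h4 : (1 / √N) * (1 / √y) ≤ 1 := mul_le_one₀ h2 (by positivity) h3
    have h5 : 0 ≤ K * (1 / √N) := by positivity
    rw [h1]
    nlinarith
  set ct := c - 2 * ε * w with hct
  set g := x * ct - ρ with hg
  have hη : 0 < vmax * √y := by positivity
  -- Expanding the square and dividing by twice the step size; projecting onto `[0, ∞)` only brings
  -- the iterate closer to `u`.
  have hstep : vmax * √y / 2 * ((max (lam + 1 / (vmax * √y) * g) 0 - u) ^ 2 - (lam - u) ^ 2) ≤
      (lam - u) * g + g ^ 2 / vmax * (1 / √y) / 2 := by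
    have h1 := sq_max_sub_le (a := lam + 1 / (vmax * √y) * g) hu0
    calc _ ≤ vmax * √y / 2 * ((lam + 1 / (vmax * √y) * g - u) ^ 2 - (lam - u) ^ 2) := by
          gcongr
      _ = _ := by field_simp; ring
  have hg2 : g ^ 2 / vmax * (1 / √y) / 2 ≤ 4 * vmax * (1 / √y) + 4 * vmax * K * (x * (1 / √N)) :=
    sq_gradient_le hρ hρv ⟨hw0, hw1⟩ hε0 (by positivity) hc (hx.imp And.left And.left)
      hεsq
  -- The decision `x` against entering with probability `α`: the better of two options beats any
  -- mixture, and the mixture costs `α * ct ≤ ρ`.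
  have hdec : α * (r + ε * w) + lam * g ≤ x * (r + ε * w) := by
    have h1 : α * ct ≤ ρ := by
      have h2 : ct ≤ vmax := by
        have := hc.2
        have : 0 ≤ ε * w := by positivity
        rw [hct]; linarith
      calc α * ct ≤ α * vmax := by gcongr
        _ = ρ := hαv
    have h2 := mul_le_mul_of_nonneg_left h1 hlam
    rcases hx with ⟨rfl, h⟩ | ⟨rfl, h⟩
    · have h3 := mul_nonneg (sub_nonneg.2 hα1) (sub_nonneg.2 h)
      rw [hg]; linarith
    · have h3 := mul_nonneg hα0.le (sub_nonneg.2 h.le)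
      rw [hg]; linarith
  have hr := abs_le.1 her
  have hcb := abs_le.1 hec
  -- Optimism makes the comparator side free of the radius. The decision side pays `2 * ε * w` for
  -- revenue and `3 * ε * w` for cost; with the `4` of `hg2` this gives the constant `9`.
  have h1 : α * (rbar - er) ≤ α * (r + ε * w) :=
    mul_le_mul_of_nonneg_left (by linarith) hα0.le
  have h2 : x * (r + ε * w) ≤ x * (rbar + er + 2 * (ε * w)) :=
    mul_le_mul_of_nonneg_left (by linarith) hx0
  have h3 : x * (cbar - ec - 3 * (ε * w)) ≤ x * ct :=
    mul_le_mul_of_nonneg_left (by rw [hct]; linarith) hx0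
  have h4 : α * er ≤ er := mul_le_of_le_one_left her0 hα1
  have h5 : x * er ≤ er := mul_le_of_le_one_left her0 hx1
  have h6 : x * ec ≤ ec := mul_le_of_le_one_left hec0 hx1
  have h7 : x * (ε * w) ≤ x * ((1 + K) * (1 / √N) * vmax) :=
    mul_le_mul_of_nonneg_left (mul_le_mul hεK hw1 hw0 (by positivity)) hx0
  have h8 : 0 ≤ x * (ε * w) := by positivity
  have h9 := mul_le_mul_of_nonneg_left h3 hu0
  have h10 : u * (x * ec) ≤ ec := (mul_le_of_le_one_left (by positivity) hu1).trans h6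
  have h11 : u * (x * (ε * w)) ≤ x * (ε * w) := mul_le_of_le_one_left h8 hu1
  have h12 : 0 ≤ vmax * (x * (1 / √N)) := by positivity
  have h13 : (lam - u) * g = lam * g - u * (x * ct) + u * ρ := by rw [hg]; ring
  linarith

/-- The decision in round `t`. -/
noncomputable def decision (vmax ρ : ℝ) (T : ℕ) (v p : ℕ → ℝ) (t : ℕ) : ℝ :=
  action T v p t (stateAfter vmax ρ T v p (t - 1))

/-- The estimation errors of round `t` beyond the confidence radius. -/
noncomputable def roundExcess (vmax ρ : ℝ) (T : ℕ) (v p rbar cbar : ℕ → ℝ) (t : ℕ) : ℝ :=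
  2 * excess T p (stateAfter vmax ρ T v p (t - 1)) (reward (v t)) (v t) (rbar t) +
    excess T p (stateAfter vmax ρ T v p (t - 1)) (cost (v t)) (v t) (cbar t)

theorem roundExcess_nonneg (vmax ρ : ℝ) (T : ℕ) (v p rbar cbar : ℕ → ℝ) (t : ℕ) :
    0 ≤ roundExcess vmax ρ T v p rbar cbar t := by
  unfold roundExcess
  have h1 := excess_nonneg T p (stateAfter vmax ρ T v p (t - 1)) (reward (v t)) (v t) (rbar t)
  have h2 := excess_nonneg T p (stateAfter vmax ρ T v p (t - 1)) (cost (v t)) (v t) (cbar t)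
  linarith

section Pathwise

variable {vmax ρ : ℝ} {T : ℕ} {v p rbar cbar : ℕ → ℝ}

/-- The realised cost is added and subtracted to separate the budget from the martingale noise.
After stopping, `λ` is frozen and the inequality survives for `u = 1`, because `ρ / vmax * rbar ≤
ρ`. -/
theorem primal_dual_step (hρ : 0 < ρ) (hρv : ρ ≤ vmax) (hv : ∀ t, v t ∈ Set.Icc 0 vmax)
    (hp : ∀ t, 0 ≤ p t) (hr : ∀ t, rbar t ∈ Set.Icc 0 (v t))
    {u : ℝ} (hu : u = 0 ∨ u = 1) (t : ℕ)
    (ha : u = 1 ∨ (stateAfter vmax ρ T v p (t + 1)).active = true) :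
    vmax * √((t + 2 : ℕ) : ℝ) / 2 * (((stateAfter vmax ρ T v p (t + 2)).lam - u) ^ 2
        - ((stateAfter vmax ρ T v p (t + 1)).lam - u) ^ 2) ≤
      decision vmax ρ T v p (t + 2) * rbar (t + 2) - ρ / vmax * rbar (t + 2)
        + u * (ρ - decision vmax ρ T v p (t + 2) * cost (v (t + 2)) (p (t + 2)))
        + u * (decision vmax ρ T v p (t + 2) * (cost (v (t + 2)) (p (t + 2)) - cbar (t + 2)))
        + roundExcess vmax ρ T v p rbar cbar (t + 2)
        + 9 * vmax * (1 + radiusSq T) * (decision vmax ρ T v p (t + 2) *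
          (1 / √((stateAfter vmax ρ T v p (t + 1)).observed.card : ℝ)))
        + 4 * vmax * (1 / √((t + 2 : ℕ) : ℝ)) := by
  have hvm : 0 < vmax := hρ.trans_le hρv
  have hE := roundExcess_nonneg vmax ρ T v p rbar cbar (t + 2)
  have hS : stateAfter vmax ρ T v p (t + 2) =
    step vmax ρ T v p (t + 2) (stateAfter vmax ρ T v p (t + 1)) := rfl
  have hD : decision vmax ρ T v p (t + 2) =
    action T v p (t + 2) (stateAfter vmax ρ T v p (t + 1)) := rfl
  have hN := one_le_card_observed vmax ρ T v p t
  have hlam := lam_nonneg (vmax := vmax) (ρ := ρ) (T := T) (v := v) (p := p) (t + 1)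
  rw [hS, hD]
  unfold roundExcess at *
  rw [show t + 2 - 1 = t + 1 from rfl] at *
  set s := stateAfter vmax ρ T v p (t + 1)
  by_cases h : s.active = true
  · rw [lam_step h (by omega), stepSize]
    have her := abs_average_sub_le T p s (reward (v (t + 2))) (v (t + 2)) (rbar (t + 2))
    have hec := abs_average_sub_le T p s (cost (v (t + 2))) (v (t + 2)) (cbar (t + 2))
    rw [radius_eq] at her hec
    have hmem : (∑ τ ∈ s.observed, cost (v (t + 2)) (p τ)) / (s.observed.card : ℝ) ∈
        Set.Icc 0 (v (t + 2)) :=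
      ⟨average_nonneg fun i _ => cost_nonneg (hp i),
        average_le (hv _).1 fun i _ => cost_le (hv _).1⟩
    rw [estCost, radius_eq]
    refine primal_dual_round hρ hρv (hv (t + 2)) (radiusSq_nonneg T) hN ?_ hlam hu hmem ?_
      her hec (excess_nonneg ..) (excess_nonneg ..)
    · exact_mod_cast (by omega : 1 ≤ t + 2)
    · have ht : ¬ (t + 2 = 1) := by omega
      by_cases hd : s.lam * estCost T p s (v (t + 2)) ≤ estReward T p s (v (t + 2))
      · left
        refine ⟨by simp [action, h, hd], ?_⟩
        simpa only [estCost, estReward, radius_eq] using hd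
      · right
        refine ⟨by simp only [action, h, hd, ht, or_self, and_false, if_false], ?_⟩
        simpa only [estCost, estReward, radius_eq, not_le] using hd
  · have hu1 : u = 1 := ha.resolve_right h
    rw [step_of_inactive h, action_of_inactive h, hu1]
    have h1 : ρ / vmax * rbar (t + 2) ≤ ρ := by
      rw [div_mul_eq_mul_div, div_le_iff₀ hvm]
      have := (hr (t + 2)).2.trans (hv (t + 2)).2
      gcongr
    have h2 : 0 ≤ 4 * vmax * (1 / √((t + 2 : ℕ) : ℝ)) := by positivity
    simp only [sub_self, mul_zero, zero_mul, sub_zero, one_mul]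
    linarith

/-- Summation by parts in inductive form. Subtracting the uniform bound `(2 * vmax / ρ + 2) ^ 2` on
the squared distance makes the bracket nonpositive, so the weight `√t` may be increased from one
round to the next. The summand `3 * vmax` covers round `1`, which has no estimates. -/
theorem primal_dual_sum (hρ : 0 < ρ) (hρv : ρ ≤ vmax) (hv : ∀ t, v t ∈ Set.Icc 0 vmax)
    (hp : ∀ t, 0 ≤ p t) (hr : ∀ t, rbar t ∈ Set.Icc 0 (v t)) (hc : ∀ t, cbar t ∈ Set.Icc 0 (v t))
    {u : ℝ} (hu : u = 0 ∨ u = 1) (t : ℕ)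
    (ha : u = 1 ∨ (stateAfter vmax ρ T v p (t + 1)).active = true) :
    vmax * √((t + 1 : ℕ) : ℝ) / 2 * (((stateAfter vmax ρ T v p (t + 1)).lam - u) ^ 2
        - (2 * vmax / ρ + 2) ^ 2) ≤
      ∑ s ∈ Finset.Icc 1 (t + 1), (decision vmax ρ T v p s * rbar s - ρ / vmax * rbar s
        + u * (ρ - decision vmax ρ T v p s * cost (v s) (p s))
        + u * (decision vmax ρ T v p s * (cost (v s) (p s) - cbar s))
        + roundExcess vmax ρ T v p rbar cbar s) + 3 * vmax
        + 9 * vmax * (1 + radiusSq T) *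
          (3 * √((stateAfter vmax ρ T v p (t + 1)).observed.card : ℝ))
        + 4 * vmax * (3 * √((t + 1 : ℕ) : ℝ)) := by
  have hvm : 0 < vmax := hρ.trans_le hρv
  have hK := radiusSq_nonneg T
  have hα1 : ρ / vmax ≤ 1 := (div_le_one hvm).2 hρv
  have hα0 : 0 < ρ / vmax := by positivity
  have hu0 : 0 ≤ u := by rcases hu with rfl | rfl <;> norm_num
  have hu1 : u ≤ 1 := by rcases hu with rfl | rfl <;> norm_num
  have hD : ∀ t, ((stateAfter vmax ρ T v p t).lam - u) ^ 2 ≤ (2 * vmax / ρ + 2) ^ 2 := fun t => by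
    have h1 := lam_le (T := T) hρ hρv hv hp t
    have h2 := lam_nonneg (vmax := vmax) (ρ := ρ) (T := T) (v := v) (p := p) t
    exact sq_le_sq' (by linarith) (by linarith)
  induction t with
  | zero =>
    have hx : decision vmax ρ T v p 1 = 1 := by simp [decision, action, stateAfter, State.init]
    have hE := roundExcess_nonneg vmax ρ T v p rbar cbar 1
    have h1 : 0 ≤ vmax * √((0 + 1 : ℕ) : ℝ) / 2 := by positivity
    have h2 := mul_nonneg h1 (sub_nonneg.2 (hD (0 + 1)))
    have h3 : 0 ≤ 9 * vmax * (1 + radiusSq T) *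
          (3 * √((stateAfter vmax ρ T v p (0 + 1)).observed.card : ℝ)) := by positivity
    have h4 : 0 ≤ 4 * vmax * (3 * √((0 + 1 : ℕ) : ℝ)) := by positivity
    simp only [Nat.zero_add, Finset.Icc_self, Finset.sum_singleton, hx] at *
    have h5 := hr 1
    have h6 := (hc 1).2.trans (hv 1).2
    have h7 : ρ / vmax * rbar 1 ≤ rbar 1 := mul_le_of_le_one_left h5.1 hα1
    have h8 : u * cbar 1 ≤ cbar 1 := mul_le_of_le_one_left (hc 1).1 hu1
    have h9 : 0 ≤ u * ρ := by positivity
    linarith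
  | succ t ih =>
    have ha' : u = 1 ∨ (stateAfter vmax ρ T v p (t + 1)).active = true :=
      ha.imp_right fun h => active_of_step h
    have h1 := ih ha'
    have h2 := primal_dual_step (cbar := cbar) hρ hρv hv hp hr hu t ha'
    rw [Finset.sum_Icc_succ_top (by omega)]
    have hN := one_le_card_observed vmax ρ T v p t
    have hcard := card_observed_succ vmax ρ T v p (t + 1)
    have hdec : decision vmax ρ T v p (t + 2) =
      action T v p (t + 2) (stateAfter vmax ρ T v p (t + 1)) := rfl
    have h3 : decision vmax ρ T v p (t + 2) *
          (1 / √((stateAfter vmax ρ T v p (t + 1)).observed.card : ℝ)) ≤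
        3 * √((stateAfter vmax ρ T v p (t + 2)).observed.card : ℝ) -
          3 * √((stateAfter vmax ρ T v p (t + 1)).observed.card : ℝ) := by
      rw [hcard, hdec]
      rcases action_eq T v p (t + 2) (stateAfter vmax ρ T v p (t + 1)) with h | h
      · simp [h]
      · rw [h, one_mul]
        exact inv_sqrt_le hN
    have h4 : 1 / √((t + 2 : ℕ) : ℝ) ≤ 3 * √((t + 2 : ℕ) : ℝ) - 3 * √((t + 1 : ℕ) : ℝ) := by
      have := inv_sqrt_succ_le (x := ((t + 1 : ℕ) : ℝ)) (Nat.cast_nonneg _)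
      have h : ((t + 1 : ℕ) : ℝ) + 1 = ((t + 2 : ℕ) : ℝ) := by push_cast; ring
      rwa [h] at this
    have h5 : √((t + 1 : ℕ) : ℝ) ≤ √((t + 2 : ℕ) : ℝ) :=
      Real.sqrt_le_sqrt (by push_cast; linarith)
    have h6 := mul_nonneg (mul_nonneg hvm.le (sub_nonneg.2 h5)) (sub_nonneg.2 (hD (t + 1)))
    have h7 := mul_le_mul_of_nonneg_left h3 (by positivity : 0 ≤ 9 * vmax * (1 + radiusSq T))
    have h8 := mul_le_mul_of_nonneg_left h4 (by positivity : 0 ≤ 4 * vmax)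
    rw [show t + 1 + 1 = t + 2 from rfl]
    linarith

/-- The constant of the pathwise revenue bound. -/
noncomputable def regretConst (vmax ρ : ℝ) : ℝ :=
  43 * vmax + vmax / 2 * (2 * vmax / ρ + 2) ^ 2

/-- The `43` in `regretConst` is `27 + 12 + 4`: the radii, the step sizes, and `3 * vmax` for round
`1` together with a leftover budget below `vmax`. -/
theorem pathwise_revenue (hρ : 0 < ρ) (hρv : ρ ≤ vmax) (hv : ∀ t, v t ∈ Set.Icc 0 vmax)
    (hp : ∀ t, 0 ≤ p t) (hr : ∀ t, rbar t ∈ Set.Icc 0 (v t)) (hc : ∀ t, cbar t ∈ Set.Icc 0 (v t))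
    (hT : 1 ≤ T) :
    ρ / vmax * ∑ s ∈ Finset.Icc 1 T, rbar s ≤ ∑ s ∈ Finset.Icc 1 T, decision vmax ρ T v p s * rbar s
      + |∑ s ∈ Finset.Icc 1 T, decision vmax ρ T v p s * (cost (v s) (p s) - cbar s)|
      + ∑ s ∈ Finset.Icc 1 T, roundExcess vmax ρ T v p rbar cbar s
      + regretConst vmax ρ * (1 + radiusSq T) * √T := by
  have hvm : 0 < vmax := hρ.trans_le hρv
  have hK := radiusSq_nonneg T
  obtain ⟨n, rfl⟩ : ∃ n, T = n + 1 := ⟨T - 1, by omega⟩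
  set T := n + 1
  have hT1 : 1 ≤ √(T : ℝ) := Real.one_le_sqrt.2 (by exact_mod_cast hT)
  have hcard : √((stateAfter vmax ρ T v p T).observed.card : ℝ) ≤ √(T : ℝ) :=
    Real.sqrt_le_sqrt (by exact_mod_cast card_observed_le vmax ρ T v p T)
  have h1 := mul_le_mul_of_nonneg_left hcard (by positivity : 0 ≤ 27 * vmax * (1 + radiusSq T))
  have hKT : 0 ≤ radiusSq T * √(T : ℝ) := by positivity
  have h2 : 4 * vmax ≤ 4 * vmax * √(T : ℝ) := le_mul_of_one_le_right (by positivity) hT1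
  have h3 : 0 ≤ vmax * (radiusSq T * √(T : ℝ)) := by positivity
  have h4 : 0 ≤ vmax / 2 * (2 * vmax / ρ + 2) ^ 2 * (radiusSq T * √(T : ℝ)) := by positivity
  have h5 : ∀ u : ℝ, 0 ≤ vmax * √(T : ℝ) / 2 * ((stateAfter vmax ρ T v p T).lam - u) ^ 2 :=
    fun u => by positivity
  unfold regretConst
  -- Comparator `0` if the loop is never left, comparator `1` if the budget ran out.
  by_cases ha : (stateAfter vmax ρ T v p T).active = true
  · have h := primal_dual_sum (T := T) hρ hρv hv hp hr hc (Or.inl rfl) n (Or.inr ha)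
    rw [show n + 1 = T from rfl] at h
    simp only [zero_mul, add_zero] at h
    rw [Finset.sum_add_distrib, Finset.sum_sub_distrib, ← Finset.mul_sum] at h
    have h6 := abs_nonneg
      (∑ s ∈ Finset.Icc 1 T, decision vmax ρ T v p s * (cost (v s) (p s) - cbar s))
    linarith [h5 0]
  · have h := primal_dual_sum (T := T) hρ hρv hv hp hr hc (Or.inr rfl) n (Or.inl rfl)
    rw [show n + 1 = T from rfl] at h
    have hb := budget_lt_of_inactive vmax ρ T v p T ha
    rw [budget_eq] at hb
    have hb' : ∑ s ∈ Finset.Icc 1 T, (ρ - decision vmax ρ T v p s * cost (v s) (p s)) < vmax := by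
      rw [Finset.sum_sub_distrib]
      simpa [decision, mul_comm] using hb
    simp only [one_mul] at h
    rw [Finset.sum_add_distrib, Finset.sum_add_distrib, Finset.sum_add_distrib,
      Finset.sum_sub_distrib, ← Finset.mul_sum] at h
    have h6 := le_abs_self
      (∑ s ∈ Finset.Icc 1 T, decision vmax ρ T v p s * (cost (v s) (p s) - cbar s))
    linarith [h5 1]

end Pathwise

/-! ### Measurability of the states and of the benchmark. -/

theorem measurable_reward (w : ℝ) : Measurable (reward w) := by
  unfold reward; fun_prop

theorem measurable_cost (w : ℝ) : Measurable (cost w) :=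
  Measurable.ite (measurableSet_le measurable_id measurable_const) measurable_id measurable_const

/-- All components of a random state are measurable. -/
structure MeasurableState {Ω : Type*} [MeasurableSpace Ω] (s : Ω → State) : Prop where
  active : MeasurableSet {ω | (s ω).active = true}
  observed : ∀ S, MeasurableSet {ω | (s ω).observed = S}
  lam : Measurable fun ω => (s ω).lam
  budget : Measurable fun ω => (s ω).budget

section Measurability

variable {Ω : Type*} [MeasurableSpace Ω] {s : Ω → State} {p : Ω → ℕ → ℝ}

/-- There are only countably many finite sets of rounds, so measurability may be checked with the
random set of observations held fixed. -/
theorem MeasurableState.comp_observed (hs : MeasurableState s) {h : Finset ℕ → Ω → ℝ}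
    (hh : ∀ S, Measurable (h S)) : Measurable fun ω => h (s ω).observed ω := by
  let m : MeasurableSpace (Finset ℕ) := ⊤
  have h1 : Measurable fun ω => (s ω).observed := measurable_to_countable' fun S => hs.observed S
  have h2 : Measurable fun q : Finset ℕ × Ω => h q.1 q.2 :=
    measurable_from_prod_countable_right hh
  exact h2.comp (h1.prodMk measurable_id)

theorem MeasurableState.average (hs : MeasurableState s) (hp : ∀ t, Measurable fun ω => p ω t)
    {f : ℝ → ℝ} (hf : Measurable f) : Measurable fun ω =>
      (∑ τ ∈ (s ω).observed, f (p ω τ)) / ((s ω).observed.card : ℝ) :=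
  hs.comp_observed (h := fun S ω => (∑ τ ∈ S, f (p ω τ)) / (S.card : ℝ)) fun _ =>
    (Finset.measurable_sum _ fun τ _ => hf.comp (hp τ)).div_const _

theorem MeasurableState.radius (hs : MeasurableState s) (T : ℕ) :
    Measurable fun ω => radius T (s ω) :=
  hs.comp_observed
    (h := fun S _ => Real.sqrt ((Real.log 2 + 2 * Real.log T) / (2 * (S.card : ℝ))))
    fun _ => measurable_const

theorem MeasurableState.estCost (hs : MeasurableState s) (hp : ∀ t, Measurable fun ω => p ω t)
    (T : ℕ) (w : ℝ) : Measurable fun ω => estCost T (p ω) (s ω) w :=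
  (hs.average hp (measurable_cost w)).sub (((hs.radius T).const_mul 2).mul_const w)

theorem MeasurableState.estReward (hs : MeasurableState s) (hp : ∀ t, Measurable fun ω => p ω t)
    (T : ℕ) (w : ℝ) : Measurable fun ω => estReward T (p ω) (s ω) w :=
  (hs.average hp (measurable_reward w)).add ((hs.radius T).mul_const w)

theorem MeasurableState.action (hs : MeasurableState s) (hp : ∀ t, Measurable fun ω => p ω t)
    (T : ℕ) (v : ℕ → ℝ) (t : ℕ) : Measurable fun ω => action T v (p ω) t (s ω) := by
  refine Measurable.ite ?_ measurable_const measurable_const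
  refine hs.active.inter ?_
  exact (MeasurableSet.const (t = 1)).union
    (measurableSet_le (hs.lam.mul (hs.estCost hp T _)) (hs.estReward hp T _))

theorem MeasurableState.excess (hs : MeasurableState s) (hp : ∀ t, Measurable fun ω => p ω t)
    (T : ℕ) {f : ℝ → ℝ} (hf : Measurable f) (w μ : ℝ) :
    Measurable fun ω => excess T (p ω) (s ω) f w μ :=
  (((hs.average hp hf).sub_const μ).abs.sub ((hs.radius T).mul_const w)).max measurable_const

theorem MeasurableState.step (hs : MeasurableState s) (hp : ∀ t, Measurable fun ω => p ω t)
    (vmax ρ : ℝ) (T : ℕ) (v : ℕ → ℝ) (t : ℕ) :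
    MeasurableState fun ω => step vmax ρ T v (p ω) t (s ω) := by
  have hx := hs.action hp T v t
  have hc : Measurable fun ω => Throttling.action T v (p ω) t (s ω) * cost (v t) (p ω t) :=
    hx.mul ((measurable_cost _).comp (hp t))
  have hb : Measurable fun ω => (Throttling.step vmax ρ T v (p ω) t (s ω)).budget := by
    simp only [budget_step]
    exact hs.budget.sub hc
  refine ⟨?_, ?_, ?_, hb⟩
  · have : {ω | (Throttling.step vmax ρ T v (p ω) t (s ω)).active = true} =
        {ω | (s ω).active = true} ∩
          {ω | vmax ≤ (Throttling.step vmax ρ T v (p ω) t (s ω)).budget} := by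
      ext ω
      by_cases h : (s ω).active = true
      · simp [Throttling.step, h]
      · simp [step_of_inactive h, h]
    rw [this]
    exact hs.active.inter (measurableSet_le measurable_const hb)
  · intro S
    have h1 : MeasurableSet {ω | Throttling.action T v (p ω) t (s ω) = 1} :=
      hx (measurableSet_singleton 1)
    have h2 : MeasurableSet {ω | insert t (s ω).observed = S} := by
      have : {ω | insert t (s ω).observed = S} =
          ⋃ S' ∈ {S' : Finset ℕ | insert t S' = S}, {ω | (s ω).observed = S'} := by
        ext ω; simp
      rw [this]
      exact MeasurableSet.biUnion (Set.to_countable _) fun S' _ => hs.observed S'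
    have : {ω | (Throttling.step vmax ρ T v (p ω) t (s ω)).observed = S} =
        ({ω | Throttling.action T v (p ω) t (s ω) = 1} ∩ {ω | insert t (s ω).observed = S}) ∪
        ({ω | Throttling.action T v (p ω) t (s ω) = 1}ᶜ ∩ {ω | (s ω).observed = S}) := by
      ext ω
      simp only [observed_step, Set.mem_ofPred_eq, Set.mem_union, Set.mem_inter_iff,
        Set.mem_compl_iff]
      split_ifs with h <;> simp [h]
    rw [this]
    exact (h1.inter h2).union (h1.compl.inter (hs.observed S))
  · have : (fun ω => (Throttling.step vmax ρ T v (p ω) t (s ω)).lam) = fun ω =>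
        if (s ω).active = true then
          if t = 1 then (s ω).lam else max ((s ω).lam + stepSize vmax t *
            (Throttling.action T v (p ω) t (s ω) * Throttling.estCost T (p ω) (s ω) (v t) - ρ)) 0
        else (s ω).lam := by
      ext ω
      by_cases h : (s ω).active = true
      · simp [Throttling.step, h]
      · simp [step_of_inactive h, h]
    rw [this]
    refine Measurable.ite hs.active ?_ hs.lam
    split_ifs
    · exact hs.lam
    · exact (hs.lam.add (((hx.mul (hs.estCost hp T _)).sub_const ρ).const_mul _)).max
        measurable_const

theorem measurableState_stateAfter (hp : ∀ t, Measurable fun ω => p ω t)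
    (vmax ρ : ℝ) (T : ℕ) (v : ℕ → ℝ) (t : ℕ) :
    MeasurableState fun ω => stateAfter vmax ρ T v (p ω) t := by
  induction t with
  | zero =>
    exact ⟨MeasurableSet.const (true = true), fun S => MeasurableSet.const ((∅ : Finset ℕ) = S),
      measurable_const, measurable_const⟩
  | succ t ih => exact ih.step hp vmax ρ T v (t + 1)

theorem measurable_decision (hp : ∀ t, Measurable fun ω => p ω t)
    (vmax ρ : ℝ) (T : ℕ) (v : ℕ → ℝ) (t : ℕ) :
    Measurable fun ω => decision vmax ρ T v (p ω) t :=
  (measurableState_stateAfter hp vmax ρ T v (t - 1)).action hp T v t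

theorem measurable_roundExcess (hp : ∀ t, Measurable fun ω => p ω t)
    (vmax ρ : ℝ) (T : ℕ) (v rbar cbar : ℕ → ℝ) (t : ℕ) :
    Measurable fun ω => roundExcess vmax ρ T v (p ω) rbar cbar t :=
  have hs := measurableState_stateAfter hp vmax ρ T v (t - 1)
  ((hs.excess hp T (measurable_reward _) _ _).const_mul 2).add
    (hs.excess hp T (measurable_cost _) _ _)

/-- A finite maximum over an index set independent of `p`, which makes measurability visible.
Infeasible sets may count as `0`, the revenue of the feasible empty set. -/
theorem hindsight_eq_sup' {ρ : ℝ} (hρ : 0 ≤ ρ) (T : ℕ) (v p : ℕ → ℝ) :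
    hindsight ρ T v p = (Finset.Icc 1 T).powerset.sup' (Finset.powerset_nonempty _) fun S =>
      if ∑ t ∈ S, cost (v t) (p t) ≤ T * ρ then ∑ t ∈ S, reward (v t) (p t) else 0 := by
  obtain ⟨⟨S, hS, hc, hR⟩, hub⟩ := hindsight_isGreatest hρ T v p
  apply le_antisymm
  · rw [hR]
    refine (Finset.le_sup' _ (Finset.mem_powerset.2 hS)).trans' ?_
    rw [if_pos hc]
  · refine Finset.sup'_le _ _ fun S' hS' => ?_
    split_ifs with h
    · exact hub ⟨S', Finset.mem_powerset.1 hS', h, rfl⟩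
    · exact hub ⟨∅, by simp, by simpa using mul_nonneg (Nat.cast_nonneg T) hρ, by simp⟩

theorem measurable_hindsight {ρ : ℝ} (hρ : 0 ≤ ρ) (hp : ∀ t, Measurable fun ω => p ω t)
    (T : ℕ) (v : ℕ → ℝ) : Measurable fun ω => hindsight ρ T v (p ω) := by
  have : (fun ω => hindsight ρ T v (p ω)) =
      (Finset.Icc 1 T).powerset.sup' (Finset.powerset_nonempty _) fun S ω =>
      if ∑ t ∈ S, cost (v t) (p ω t) ≤ T * ρ then ∑ t ∈ S, reward (v t) (p ω t) else 0 := by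
    ext ω
    rw [hindsight_eq_sup' hρ, Finset.sup'_apply]
  rw [this]
  refine Finset.measurable_sup' _ fun S _ => Measurable.ite ?_ ?_ measurable_const
  · exact measurableSet_le
      (Finset.measurable_sum _ fun t _ => (measurable_cost _).comp (hp t)) measurable_const
  · exact Finset.measurable_sum _ fun t _ => (measurable_reward _).comp (hp t)

end Measurability

theorem hindsight_nonneg {ρ : ℝ} (hρ : 0 ≤ ρ) (T : ℕ) (v p : ℕ → ℝ) : 0 ≤ hindsight ρ T v p :=
  (hindsight_isGreatest hρ T v p).2
    ⟨∅, by simp, by simpa using mul_nonneg (Nat.cast_nonneg T) hρ, by simp⟩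

theorem hindsight_le {ρ : ℝ} (hρ : 0 ≤ ρ) (T : ℕ) (v p : ℕ → ℝ) :
    hindsight ρ T v p ≤ ∑ t ∈ Finset.Icc 1 T, reward (v t) (p t) := by
  obtain ⟨⟨S, hS, -, hR⟩, -⟩ := hindsight_isGreatest hρ T v p
  rw [hR]
  exact Finset.sum_le_sum_of_subset_of_nonneg hS fun t _ _ => reward_nonneg _ _

/-! ### Decisions depend on earlier bids only. -/

theorem action_congr {T : ℕ} {v p p' : ℕ → ℝ} {t : ℕ} {s : State}
    (h : ∀ τ ∈ s.observed, p τ = p' τ) : action T v p t s = action T v p' t s := by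
  have h1 : estCost T p s (v t) = estCost T p' s (v t) := by
    unfold estCost
    rw [Finset.sum_congr rfl fun τ hτ => by rw [h τ hτ]]
  have h2 : estReward T p s (v t) = estReward T p' s (v t) := by
    unfold estReward
    rw [Finset.sum_congr rfl fun τ hτ => by rw [h τ hτ]]
  unfold action
  rw [h1, h2]

theorem step_congr {vmax ρ : ℝ} {T : ℕ} {v p p' : ℕ → ℝ} {t : ℕ} {s : State}
    (h : ∀ τ ∈ s.observed, p τ = p' τ) (ht : p t = p' t) :
    step vmax ρ T v p t s = step vmax ρ T v p' t s := by
  have h1 : estCost T p s (v t) = estCost T p' s (v t) := by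
    unfold estCost
    rw [Finset.sum_congr rfl fun τ hτ => by rw [h τ hτ]]
  unfold step
  rw [action_congr h, h1, ht]

theorem stateAfter_congr {vmax ρ : ℝ} {T : ℕ} {v p p' : ℕ → ℝ} {t : ℕ}
    (h : ∀ τ ∈ Finset.Icc 1 t, p τ = p' τ) :
    stateAfter vmax ρ T v p t = stateAfter vmax ρ T v p' t := by
  induction t with
  | zero => rfl
  | succ t ih =>
    have ih' := ih fun τ hτ => h τ (Finset.Icc_subset_Icc_right (by omega) hτ)
    rw [stateAfter, stateAfter, ← ih']
    refine step_congr (fun τ hτ => h τ ?_) (h _ (by simp))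
    exact Finset.Icc_subset_Icc_right (by omega) (observed_subset vmax ρ T v p t hτ)

theorem decision_congr {vmax ρ : ℝ} {T : ℕ} {v p p' : ℕ → ℝ} {t : ℕ}
    (h : ∀ τ ∈ Finset.Icc 1 (t - 1), p τ = p' τ) :
    decision vmax ρ T v p t = decision vmax ρ T v p' t := by
  unfold decision
  rw [← stateAfter_congr h]
  exact action_congr fun τ hτ => h τ (observed_subset vmax ρ T v p _ hτ)

section Rounds

variable {vmax : ℝ} {T : ℕ}

theorem rounds_mem (h : 0 ≤ vmax) (w : Fin T → Set.Icc (0 : ℝ) vmax) (t : ℕ) :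
    rounds w t ∈ Set.Icc 0 vmax := by
  unfold rounds
  split_ifs
  · exact Subtype.property _
  · exact ⟨le_rfl, h⟩

theorem rounds_succ (w : Fin T → Set.Icc (0 : ℝ) vmax) (i : Fin T) :
    -- Coordinates start at `0` and rounds at `1`: the bid of round `i + 1` is coordinate `i`.
    rounds w (i + 1) = w i := by
  have h : 1 ≤ (i : ℕ) + 1 ∧ (i : ℕ) + 1 ≤ T := ⟨by omega, i.2⟩
  simp [rounds, h]

theorem measurable_rounds (t : ℕ) :
    Measurable fun w : Fin T → Set.Icc (0 : ℝ) vmax => rounds w t := by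
  unfold rounds
  split_ifs
  · exact measurable_subtype_coe.comp (measurable_pi_apply _)
  · exact measurable_const

theorem rounds_congr {w w' : Fin T → Set.Icc (0 : ℝ) vmax} {i : Fin T}
    (h : ∀ j ∈ ({i}ᶜ : Set (Fin T)), w j = w' j) : ∀ τ ∈ Finset.Icc 1 (i : ℕ),
      rounds w τ = rounds w' τ := by
  intro τ hτ
  rw [Finset.mem_Icc] at hτ
  unfold rounds
  split_ifs with hτ'
  · rw [h]
    intro hi
    have := congrArg Fin.val hi
    simp at this
    omega
  · rfl

end Rounds

/-! ### Independence, and concentration of the empirical means under adaptive sampling. -/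

/-- A function of the other coordinates is independent of a function of coordinate `i`. -/
theorem integral_mul_eval {ι E : Type*} [Fintype ι] [MeasurableSpace E]
    (μ : Measure E) [IsProbabilityMeasure μ] {F : (ι → E) → ℝ} {g : E → ℝ} (i : ι)
    (hF : Measurable F) (hg : Measurable g) (hdep : DependsOn F {i}ᶜ) :
    ∫ ω, F ω * g (ω i) ∂(Measure.pi fun _ : ι => μ) =
      (∫ ω, F ω ∂(Measure.pi fun _ : ι => μ)) * ∫ x, g x ∂μ := by
  classical
  obtain ⟨e⟩ : Nonempty E := nonempty_of_isProbabilityMeasure μ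
  have hind : ProbabilityTheory.iIndepFun (fun (j : ι) (ω : ι → E) => ω j)
      (Measure.pi fun _ : ι => μ) :=
    ProbabilityTheory.iIndepFun_pi (X := fun _ => id) fun _ => aemeasurable_id
  have h1 := hind.indepFun_finset ({i}ᶜ : Finset ι) {i}
    (by simp) fun j => measurable_pi_apply j
  -- The missing coordinate is filled with an arbitrary point `e`, which `hdep` makes irrelevant.
  let F' : ((({i}ᶜ : Finset ι) : Type _) → E) → ℝ := fun x =>
    F fun j => if h : j ∈ ({i}ᶜ : Finset ι) then x ⟨j, h⟩ else e
  have hF' : Measurable F' := by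
    refine hF.comp (measurable_pi_lambda _ fun j => ?_)
    by_cases h : j ∈ ({i}ᶜ : Finset ι)
    · simpa only [h, dif_pos] using measurable_pi_apply _
    · simpa only [h, dif_neg, not_false_eq_true] using measurable_const
  let g' : ((({i} : Finset ι) : Type _) → E) → ℝ := fun x => g (x ⟨i, by simp⟩)
  have hg' : Measurable g' := hg.comp (measurable_pi_apply _)
  have h2 := h1.comp hF' hg'
  have h3 : (F' ∘ fun (ω : ι → E) (j : (({i}ᶜ : Finset ι) : Type _)) => ω j) = F := by
    ext ω
    refine hdep fun j hj => ?_
    have : j ∈ ({i}ᶜ : Finset ι) := by simpa using hj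
    simp [this]
  have h4 : (g' ∘ fun (ω : ι → E) (j : (({i} : Finset ι) : Type _)) => ω j) =
    fun ω => g (ω i) := rfl
  rw [h3, h4] at h2
  have h5 := h2.integral_mul_eq_mul_integral hF.aestronglyMeasurable
    (hg.comp (measurable_pi_apply i)).aestronglyMeasurable
  rw [show (fun ω => F ω * g (ω i)) = F * fun ω => g (ω i) from rfl, h5]
  congr 1
  have h6 := (measurePreserving_eval (fun _ : ι => μ) i).map_eq
  conv_rhs => rw [← h6]
  rw [integral_map (measurable_pi_apply i).aemeasurable hg.aestronglyMeasurable]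

/-- Hoeffding's lemma for a function with values in `[0, w]`. -/
theorem integral_exp_sub_le_one {E : Type*} [MeasurableSpace E] (μ : Measure E)
    [IsProbabilityMeasure μ] {f : E → ℝ} (hf : Measurable f) {w : ℝ}
    (hfw : ∀ x, f x ∈ Set.Icc 0 w) (σ : ℝ) :
    ∫ x, (Real.exp (σ * (f x - ∫ y, f y ∂μ) - σ ^ 2 * w ^ 2 / 8) - 1) ∂μ ≤ 0 := by
  have h := ProbabilityTheory.hasSubgaussianMGF_of_mem_Icc hf.aemeasurable
    (Eventually.of_forall hfw : ∀ᵐ x ∂μ, f x ∈ Set.Icc 0 w)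
  have h1 := h.mgf_le σ
  have h2 := h.integrable_exp_mul σ
  simp only [Real.exp_sub _ (σ ^ 2 * w ^ 2 / 8)]
  rw [integral_sub (h2.div_const _) (integrable_const _), integral_div]
  have h3 : ((((‖w - 0‖₊ / 2) ^ 2 : NNReal) : ℝ) * σ ^ 2 / 2) = σ ^ 2 * w ^ 2 / 8 := by
    push_cast
    rw [sub_zero, Real.norm_eq_abs, div_pow, sq_abs]
    ring
  rw [h3] at h1
  simp only [ProbabilityTheory.mgf] at h1
  simp only [integral_const, probReal_univ, smul_eq_mul, mul_one]
  rw [sub_nonpos, div_le_one (Real.exp_pos _)]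
  exact h1

theorem integrable_of_abs_le {Ω : Type*} [MeasurableSpace Ω] {P : Measure Ω} [IsFiniteMeasure P]
    {f : Ω → ℝ} (hf : Measurable f) (C : ℝ) (h : ∀ ω, |f ω| ≤ C) : Integrable f P :=
  Integrable.of_bound hf.aestronglyMeasurable C (Eventually.of_forall h)

section Bidding

variable {vmax ρ : ℝ} {T : ℕ} {v : ℕ → ℝ} (G : Measure (Set.Icc (0 : ℝ) vmax))

/-- The joint law of the competing bids. -/
noncomputable abbrev bidLaw (T : ℕ) : Measure (Fin T → Set.Icc (0 : ℝ) vmax) :=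
  Measure.pi fun _ => G

/-- The exponential of the centred values of `f` at the observed bids, normalised as in Hoeffding's
inequality. -/
noncomputable def expDeviation (w μ σ : ℝ) (f : ℝ → ℝ) (p : ℕ → ℝ) (S : Finset ℕ) : ℝ :=
  Real.exp (∑ τ ∈ S, (σ * (f (p τ) - μ) - σ ^ 2 * w ^ 2 / 8))

theorem dependsOn_stateAfter (i : Fin T) :
    DependsOn (fun p : Fin T → Set.Icc (0 : ℝ) vmax => stateAfter vmax ρ T v (rounds p) i)
      {i}ᶜ := fun _ _ h => stateAfter_congr (rounds_congr h)

theorem dependsOn_decision (i : Fin T) :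
    DependsOn (fun p : Fin T → Set.Icc (0 : ℝ) vmax => decision vmax ρ T v (rounds p) (i + 1))
      {i}ᶜ := fun _ _ h => decision_congr (rounds_congr h)

theorem decision_nonneg (vmax ρ : ℝ) (T : ℕ) (v p : ℕ → ℝ) (t : ℕ) :
    0 ≤ decision vmax ρ T v p t := action_nonneg ..

theorem decision_le_one (vmax ρ : ℝ) (T : ℕ) (v p : ℕ → ℝ) (t : ℕ) :
    decision vmax ρ T v p t ≤ 1 := action_le_one ..

/-- The increment is a nonnegative function of the past times a function of the new bid, the latter
with nonpositive mean by `integral_exp_sub_le_one`. -/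
theorem expDeviation_succ (vmax ρ : ℝ) (T : ℕ) (v p : ℕ → ℝ) (w μ σ : ℝ) (f : ℝ → ℝ) (t : ℕ) :
    expDeviation w μ σ f p (stateAfter vmax ρ T v p (t + 1)).observed =
      expDeviation w μ σ f p (stateAfter vmax ρ T v p t).observed +
      expDeviation w μ σ f p (stateAfter vmax ρ T v p t).observed *
        decision vmax ρ T v p (t + 1) *
        (Real.exp (σ * (f (p (t + 1)) - μ) - σ ^ 2 * w ^ 2 / 8) - 1) := by
  have hd : decision vmax ρ T v p (t + 1) = action T v p (t + 1) (stateAfter vmax ρ T v p t) := rfl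
  rw [hd, stateAfter, observed_step]
  rcases action_eq T v p (t + 1) (stateAfter vmax ρ T v p t) with h | h
  · simp [h]
  · rw [if_pos h, h, expDeviation, expDeviation,
      Finset.sum_insert (succ_notMem_observed vmax ρ T v p t), Real.exp_add]
    ring

theorem expDeviation_le {w μ σ : ℝ} {f : ℝ → ℝ} {p : ℕ → ℝ} (hf : ∀ τ, f (p τ) ∈ Set.Icc 0 w)
    (hμ : μ ∈ Set.Icc 0 w) {S : Finset ℕ} {t : ℕ} (hS : S.card ≤ t) :
    expDeviation w μ σ f p S ≤ Real.exp (t * (|σ| * w)) := by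
  unfold expDeviation
  rw [Real.exp_le_exp]
  have hw : 0 ≤ w := hμ.1.trans hμ.2
  have h1 : ∀ τ ∈ S, σ * (f (p τ) - μ) - σ ^ 2 * w ^ 2 / 8 ≤ |σ| * w := fun τ _ => by
    have h2 := abs_sub_le_of_nonneg_of_le (hf τ).1 (hf τ).2 hμ.1 hμ.2
    have h3 := le_abs_self (σ * (f (p τ) - μ))
    rw [abs_mul] at h3
    have h4 := mul_le_mul_of_nonneg_left h2 (abs_nonneg σ)
    have : 0 ≤ σ ^ 2 * w ^ 2 := by positivity
    linarith
  refine (Finset.sum_le_card_nsmul S _ _ h1).trans ?_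
  rw [nsmul_eq_mul]
  gcongr

theorem measurable_expDeviation (w μ σ : ℝ) {f : ℝ → ℝ} (hf : Measurable f) (t : ℕ) :
    Measurable fun p : Fin T → Set.Icc (0 : ℝ) vmax =>
      expDeviation w μ σ f (rounds p) (stateAfter vmax ρ T v (rounds p) t).observed :=
  (measurableState_stateAfter measurable_rounds vmax ρ T v t).comp_observed
    (h := fun S p => expDeviation w μ σ f (rounds p) S) fun S => by
      unfold expDeviation
      have := fun τ => hf.comp (measurable_rounds (vmax := vmax) (T := T) τ)
      exact (Finset.measurable_sum S fun τ _ =>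
        (((this τ).sub_const μ).const_mul σ).sub_const _).exp

variable [IsProbabilityMeasure G]

theorem expDeviation_nonneg (w μ σ : ℝ) (f : ℝ → ℝ) (p : ℕ → ℝ) (S : Finset ℕ) :
    0 ≤ expDeviation w μ σ f p S := Real.exp_nonneg _

theorem integrable_expDeviation (hvm : 0 ≤ vmax) {w μ : ℝ} {f : ℝ → ℝ} (hf : Measurable f)
    (hfw : ∀ x ∈ Set.Icc 0 vmax, f x ∈ Set.Icc 0 w) (hμ : μ ∈ Set.Icc 0 w) (σ : ℝ) (t : ℕ) :
    Integrable (fun p => expDeviation w μ σ f (rounds p)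
      (stateAfter vmax ρ T v (rounds p) t).observed) (bidLaw G T) :=
  integrable_of_abs_le (measurable_expDeviation w μ σ hf t) (Real.exp (t * (|σ| * w)))
    fun p => by
      rw [abs_of_nonneg (expDeviation_nonneg ..)]
      exact expDeviation_le (fun τ => hfw _ (rounds_mem hvm p τ)) hμ (card_observed_le ..)

/-- A function of the bids of the other rounds is independent of the bid of round `t + 1`. -/
theorem integral_mul_rounds {t : ℕ} (ht : t < T) {F : (Fin T → Set.Icc (0 : ℝ) vmax) → ℝ}
    (hF : Measurable F) (hdep : DependsOn F {⟨t, ht⟩}ᶜ) {g : ℝ → ℝ} (hg : Measurable g) :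
    ∫ p, F p * g (rounds p (t + 1)) ∂(bidLaw G T) = (∫ p, F p ∂(bidLaw G T)) * ∫ x, g x ∂G := by
  have h := integral_mul_eval G (g := fun x : Set.Icc (0 : ℝ) vmax => g x) ⟨t, ht⟩ hF
    (hg.comp measurable_subtype_coe) hdep
  rw [← h]
  refine integral_congr_ae (Eventually.of_forall fun p => ?_)
  have h1 : rounds p (t + 1) = p ⟨t, ht⟩ := rounds_succ p ⟨t, ht⟩
  simp only [h1]

theorem integral_mem_Icc {E : Type*} [MeasurableSpace E] (μ : Measure E) [IsProbabilityMeasure μ]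
    {f : E → ℝ} (hf : Measurable f) {w : ℝ} (hfw : ∀ x, f x ∈ Set.Icc 0 w) :
    ∫ x, f x ∂μ ∈ Set.Icc 0 w := by
  refine ⟨integral_nonneg fun x => (hfw x).1, ?_⟩
  have hi : Integrable f μ := integrable_of_abs_le hf w fun x => by
    rw [abs_of_nonneg (hfw x).1]; exact (hfw x).2
  calc ∫ x, f x ∂μ ≤ ∫ _, w ∂μ := integral_mono hi (integrable_const _) fun x => (hfw x).2
    _ = w := by simp

/-- The supermartingale property. It needs no independence between the set of observed rounds and
the bids observed in them, only that entering is decided before the bid is seen. -/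
theorem integral_expDeviation_le_one (hvm : 0 ≤ vmax) {w : ℝ} {f : ℝ → ℝ} (hf : Measurable f)
    (hfw : ∀ x ∈ Set.Icc 0 vmax, f x ∈ Set.Icc 0 w) (σ : ℝ) {t : ℕ} (ht : t ≤ T) :
    ∫ p, expDeviation w (∫ x, f x ∂G) σ f (rounds p)
      (stateAfter vmax ρ T v (rounds p) t).observed ∂(bidLaw G T) ≤ 1 := by
  have hf' : Measurable fun x : Set.Icc (0 : ℝ) vmax => f x := hf.comp measurable_subtype_coe
  have hμ := integral_mem_Icc G hf' (fun x => hfw x x.2)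
  set μ := ∫ x, f x ∂G
  have hint := integrable_expDeviation (ρ := ρ) (T := T) (v := v) G hvm hf hfw hμ σ
  induction t with
  | zero => simp [stateAfter, State.init, expDeviation]
  | succ t ih =>
    have ih' := ih (by omega)
    have hF : Measurable fun p : Fin T → Set.Icc (0 : ℝ) vmax =>
        expDeviation w μ σ f (rounds p) (stateAfter vmax ρ T v (rounds p) t).observed *
          decision vmax ρ T v (rounds p) (t + 1) :=
      (measurable_expDeviation w μ σ hf t).mul (measurable_decision measurable_rounds ..)
    have hg : Measurable fun x => Real.exp (σ * (f x - μ) - σ ^ 2 * w ^ 2 / 8) - 1 :=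
      (((hf.sub_const μ).const_mul σ).sub_const _).exp.sub_const 1
    have hdep : DependsOn (fun p : Fin T → Set.Icc (0 : ℝ) vmax =>
        expDeviation w μ σ f (rounds p) (stateAfter vmax ρ T v (rounds p) t).observed *
          decision vmax ρ T v (rounds p) (t + 1)) {⟨t, ht⟩}ᶜ := fun p p' h => by
      have h1 := dependsOn_stateAfter (ρ := ρ) (v := v) ⟨t, ht⟩ h
      have h2 := dependsOn_decision (ρ := ρ) (v := v) ⟨t, ht⟩ h
      simp only at h1 h2
      simp only [h2, ← h1, expDeviation]
      rw [Finset.sum_congr rfl fun τ hτ => by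
        rw [rounds_congr h τ (observed_subset vmax ρ T v (rounds p) t hτ)]]
    have h1 := integral_mul_rounds G ht hF hdep hg
    have h2 := integral_exp_sub_le_one G hf' (fun x => hfw x x.2) σ
    have h3 : 0 ≤ ∫ p, expDeviation w μ σ f (rounds p)
        (stateAfter vmax ρ T v (rounds p) t).observed *
          decision vmax ρ T v (rounds p) (t + 1) ∂(bidLaw G T) :=
      integral_nonneg fun p => mul_nonneg (Real.exp_nonneg _) (decision_nonneg ..)
    have h5 : ∫ p, (expDeviation w μ σ f (rounds p)
          (stateAfter vmax ρ T v (rounds p) (t + 1)).observed -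
        expDeviation w μ σ f (rounds p) (stateAfter vmax ρ T v (rounds p) t).observed)
          ∂(bidLaw G T) ≤ 0 := by
      simp only [expDeviation_succ, add_sub_cancel_left]
      rw [h1]
      exact mul_nonpos_of_nonneg_of_nonpos h3 h2
    rw [integral_sub (hint _) (hint _)] at h5
    linarith

/-- The excess over the confidence radius, bounded by the exponential deviations with the optimal
parameter for each possible number of observations. -/
theorem excess_le_sum {T : ℕ} {p : ℕ → ℝ} {s : State} {f : ℝ → ℝ} {w μ : ℝ} (hw : 0 < w)
    (hf : ∀ i, f (p i) ∈ Set.Icc 0 w) (hμ : μ ∈ Set.Icc 0 w) (h1 : 1 ≤ s.observed.card)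
    (hT : s.observed.card ≤ T) :
    excess T p s f w μ ≤ w * (1 / (2 * (T : ℝ) ^ 2)) * ∑ n ∈ Finset.Icc 1 T,
      (expDeviation w μ (4 * √(radiusSq T / n) / w) f p s.observed +
        expDeviation w μ (-(4 * √(radiusSq T / n) / w)) f p s.observed) := by
  set S := s.observed
  set n := S.card
  have hT0 : (0 : ℝ) < T := by exact_mod_cast h1.trans hT
  have hn0 : (0 : ℝ) < n := by exact_mod_cast h1
  set ε := √(radiusSq T / n) with hε
  have hεr : radius T s = ε := by
    rw [radius_eq, hε, Real.sqrt_div (radiusSq_nonneg T)]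
  have hε2 : 2 * n * ε ^ 2 = Real.log (2 * (T : ℝ) ^ 2) := by
    rw [hε, Real.sq_sqrt (div_nonneg (radiusSq_nonneg T) hn0.le), radiusSq,
      Real.log_mul two_ne_zero (by positivity), Real.log_pow]
    field_simp
    push_cast
    ring
  -- The radius is chosen so that Hoeffding's tail with `n` samples equals exactly this.
  have hexp : Real.exp (-(2 * n * ε ^ 2)) = 1 / (2 * (T : ℝ) ^ 2) := by
    rw [hε2, Real.exp_neg, Real.exp_log (by positivity), one_div]
  set D := ∑ τ ∈ S, (f (p τ) - μ) with hD
  have hmean : (∑ τ ∈ S, f (p τ)) / (n : ℝ) - μ = D / n := by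
    rw [hD, Finset.sum_sub_distrib, Finset.sum_const, nsmul_eq_mul]
    rw [show (S.card : ℝ) = n from rfl]
    field_simp
  have hdev : ∀ σ, expDeviation w μ σ f p S = Real.exp (σ * D - n * (σ ^ 2 * w ^ 2 / 8)) :=
    fun σ => by
      rw [expDeviation, Finset.sum_sub_distrib, ← Finset.mul_sum, Finset.sum_const, nsmul_eq_mul]
  have hpos : ∀ σ, 0 ≤ expDeviation w μ σ f p S := fun σ => Real.exp_nonneg _
  -- A deviation beyond the radius makes the exponent at least `4 * n * ε ^ 2 - 2 * n * ε ^ 2`. Thus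
  -- the indicator of this event is dominated by exponential deviations, as in Chernoff's argument.
  have hbig : ∀ σ, σ ^ 2 = (4 * ε / w) ^ 2 → 4 * n * ε ^ 2 ≤ σ * D →
      1 ≤ 1 / (2 * (T : ℝ) ^ 2) * expDeviation w μ σ f p S := fun σ hσ h => by
    rw [hdev, ← hexp, ← Real.exp_add, Real.one_le_exp_iff, hσ]
    have : (4 * ε / w) ^ 2 * w ^ 2 / 8 = 2 * ε ^ 2 := by field_simp; ring
    rw [this]
    linarith
  -- The optimal parameter depends on the random count `n`, but the supermartingale needs a
  -- deterministic one; hence the sum over all possible counts.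
  have hsingle : expDeviation w μ (4 * ε / w) f p S + expDeviation w μ (-(4 * ε / w)) f p S ≤
      ∑ n ∈ Finset.Icc 1 T, (expDeviation w μ (4 * √(radiusSq T / n) / w) f p S +
        expDeviation w μ (-(4 * √(radiusSq T / n) / w)) f p S) :=
    Finset.single_le_sum (f := fun n : ℕ => expDeviation w μ (4 * √(radiusSq T / n) / w) f p S +
        expDeviation w μ (-(4 * √(radiusSq T / n) / w)) f p S)
      (fun n _ => add_nonneg (hpos _) (hpos _)) (Finset.mem_Icc.2 ⟨h1, hT⟩)
  have hc : 0 ≤ 1 / (2 * (T : ℝ) ^ 2) := by positivity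
  refine le_trans ?_ (mul_le_mul_of_nonneg_left hsingle (mul_nonneg hw.le hc))
  by_cases hle : |D / n| ≤ ε * w
  · have : excess T p s f w μ = 0 := by
      rw [excess, hmean, hεr]
      exact max_eq_right (by linarith)
    rw [this]
    exact mul_nonneg (mul_nonneg hw.le hc) (add_nonneg (hpos _) (hpos _))
  · push Not at hle
    rw [abs_div, Nat.abs_cast, lt_div_iff₀ hn0] at hle
    have hkey : 1 ≤ 1 / (2 * (T : ℝ) ^ 2) *
        (expDeviation w μ (4 * ε / w) f p S + expDeviation w μ (-(4 * ε / w)) f p S) := by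
      have hε0 : 0 ≤ ε := Real.sqrt_nonneg _
      have h2 : 4 * n * ε ^ 2 ≤ 4 * ε / w * |D| := by
        have := mul_le_mul_of_nonneg_left hle.le (by positivity : 0 ≤ 4 * ε / w)
        have h3 : 4 * ε / w * (ε * w * n) = 4 * n * ε ^ 2 := by field_simp
        linarith
      rw [mul_add]
      rcases abs_cases D with ⟨h, -⟩ | ⟨h, -⟩
      · have := hbig (4 * ε / w) rfl (by rwa [h] at h2)
        linarith [mul_nonneg hc (hpos (-(4 * ε / w)))]
      · have := hbig (-(4 * ε / w)) (neg_sq _) (by rw [h] at h2; linarith)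
        linarith [mul_nonneg hc (hpos (4 * ε / w))]
    calc excess T p s f w μ ≤ w := excess_le hw.le hf hμ
      _ ≤ w * (1 / (2 * (T : ℝ) ^ 2) *
        (expDeviation w μ (4 * ε / w) f p S + expDeviation w μ (-(4 * ε / w)) f p S)) :=
          le_mul_of_one_le_right hw.le hkey
      _ = _ := by ring

/-- `T` possible counts and two signs contribute at most `2 * T` to the expected sum, against the
factor `1 / (2 * T ^ 2)`. -/
theorem integral_excess_le (hvm : 0 ≤ vmax) {w : ℝ} (hw : 0 ≤ w) {f : ℝ → ℝ} (hf : Measurable f)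
    (hfw : ∀ x ∈ Set.Icc 0 vmax, f x ∈ Set.Icc 0 w) {t : ℕ} (ht : t + 1 ≤ T) :
    ∫ p, excess T (rounds p) (stateAfter vmax ρ T v (rounds p) (t + 1)) f w (∫ x, f x ∂G)
      ∂(bidLaw G T) ≤ w / T := by
  have hf' : Measurable fun x : Set.Icc (0 : ℝ) vmax => f x := hf.comp measurable_subtype_coe
  have hμ := integral_mem_Icc G hf' (fun x => hfw x x.2)
  have hE : ∀ σ, ∫ p, expDeviation w (∫ x, f x ∂G) σ f (rounds p)
      (stateAfter vmax ρ T v (rounds p) (t + 1)).observed ∂(bidLaw G T) ≤ 1 := fun σ =>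
    integral_expDeviation_le_one G hvm hf hfw σ ht
  set μ := ∫ x, f x ∂G
  have hfp : ∀ (p : Fin T → Set.Icc (0 : ℝ) vmax) τ, f (rounds p τ) ∈ Set.Icc 0 w :=
    fun p τ => hfw _ (rounds_mem hvm p τ)
  have hs := measurableState_stateAfter (measurable_rounds (vmax := vmax) (T := T))
    vmax ρ T v (t + 1)
  have hint := fun σ =>
    integrable_expDeviation (ρ := ρ) (T := T) (v := v) G hvm hf hfw hμ σ (t + 1)
  have hexc : Integrable (fun p => excess T (rounds p)
      (stateAfter vmax ρ T v (rounds p) (t + 1)) f w μ) (bidLaw G T) :=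
    integrable_of_abs_le (hs.excess measurable_rounds T hf w μ) w fun p => by
      rw [abs_of_nonneg (excess_nonneg ..)]
      exact excess_le hw (hfp p) hμ
  -- The parameter `4 * ε / w` is meaningful only for `w > 0`; for `w = 0` the excess vanishes.
  rcases hw.eq_or_lt with rfl | hw0
  · have := integral_mono hexc (integrable_const (0 : ℝ)) fun p =>
      excess_le le_rfl (hfp p) hμ
    simpa using this
  have hT0 : (0 : ℝ) < T := by exact_mod_cast (Nat.succ_pos t).trans_le ht
  calc _ ≤ ∫ p, w * (1 / (2 * (T : ℝ) ^ 2)) * ∑ n ∈ Finset.Icc 1 T,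
        (expDeviation w μ (4 * √(radiusSq T / n) / w) f (rounds p)
          (stateAfter vmax ρ T v (rounds p) (t + 1)).observed +
        expDeviation w μ (-(4 * √(radiusSq T / n) / w)) f (rounds p)
          (stateAfter vmax ρ T v (rounds p) (t + 1)).observed) ∂(bidLaw G T) := by
        refine integral_mono hexc ?_ fun p => excess_le_sum hw0 (hfp p) hμ ?_ ?_
        · exact (integrable_finsetSum _ fun n _ => (hint _).add (hint _)).const_mul _
        · exact_mod_cast one_le_card_observed vmax ρ T v (rounds p) t
        · exact (card_observed_le ..).trans ht
    _ = w * (1 / (2 * (T : ℝ) ^ 2)) * ∑ n ∈ Finset.Icc 1 T,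
        (∫ p, expDeviation w μ (4 * √(radiusSq T / n) / w) f (rounds p)
          (stateAfter vmax ρ T v (rounds p) (t + 1)).observed ∂(bidLaw G T) +
        ∫ p, expDeviation w μ (-(4 * √(radiusSq T / n) / w)) f (rounds p)
          (stateAfter vmax ρ T v (rounds p) (t + 1)).observed ∂(bidLaw G T)) := by
        rw [integral_const_mul, integral_finsetSum]
        · congr 1
          exact Finset.sum_congr rfl fun n _ => integral_add (hint _) (hint _)
        · exact fun n _ => (hint _).add (hint _)
    _ ≤ w * (1 / (2 * (T : ℝ) ^ 2)) * ∑ n ∈ Finset.Icc 1 T, (1 + 1 : ℝ) := by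
        gcongr <;> exact hE _
    _ = w / T := by
        simp only [Finset.sum_const, Nat.card_Icc, Nat.add_sub_cancel, nsmul_eq_mul]
        field_simp
        norm_num

end Bidding

/-! ### Expectations of the noise, the errors, the benchmark and the revenue. -/

section Expectation

variable {vmax ρ : ℝ} {T : ℕ} {v : ℕ → ℝ} (G : Measure (Set.Icc (0 : ℝ) vmax))

theorem reward_mem (w : ℝ) (hw : 0 ≤ w) : ∀ x ∈ Set.Icc 0 vmax, reward w x ∈ Set.Icc 0 w :=
  fun x hx => ⟨reward_nonneg w x, reward_le hw hx.1⟩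

theorem cost_mem (w : ℝ) (hw : 0 ≤ w) : ∀ x ∈ Set.Icc 0 vmax, cost w x ∈ Set.Icc 0 w :=
  fun _ hx => ⟨cost_nonneg hx.1, cost_le hw⟩

/-- The expected revenue of entering with value `w`. -/
noncomputable def meanReward (w : ℝ) : ℝ := ∫ x, reward w x ∂G

/-- The expected cost of entering with value `w`. -/
noncomputable def meanCost (w : ℝ) : ℝ := ∫ x, cost w x ∂G

/-- The deviation of the total cost from the sum of its conditional means. -/
noncomputable def costNoise (vmax ρ : ℝ) (T : ℕ) (v p cbar : ℕ → ℝ) (t : ℕ) : ℝ :=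
  ∑ s ∈ Finset.Icc 1 t, decision vmax ρ T v p s * (cost (v s) (p s) - cbar s)

theorem measurable_costNoise (cbar : ℕ → ℝ) (t : ℕ) :
    Measurable fun p : Fin T → Set.Icc (0 : ℝ) vmax =>
      costNoise vmax ρ T v (rounds p) cbar t :=
  Finset.measurable_sum _ fun s _ => (measurable_decision measurable_rounds ..).mul
    (((measurable_cost (v s)).comp (measurable_rounds s)).sub_const _)

theorem abs_decision_mul_le {p : ℕ → ℝ} {t : ℕ} {y C : ℝ} (hy : |y| ≤ C) :
    |decision vmax ρ T v p t * y| ≤ C := by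
  rw [abs_mul, abs_of_nonneg (decision_nonneg ..)]
  exact (mul_le_of_le_one_left (abs_nonneg y) (decision_le_one ..)).trans hy

theorem abs_costNoise_le {p cbar : ℕ → ℝ} {C : ℝ}
    (h : ∀ s, |cost (v s) (p s) - cbar s| ≤ C) (t : ℕ) :
    |costNoise vmax ρ T v p cbar t| ≤ t * C := by
  refine (Finset.abs_sum_le_sum_abs _ _).trans ?_
  refine (Finset.sum_le_card_nsmul _ _ C fun s _ => abs_decision_mul_le (h s)).trans ?_
  simp

variable [IsProbabilityMeasure G]

theorem meanReward_mem {w : ℝ} (hw : 0 ≤ w) : meanReward G w ∈ Set.Icc 0 w :=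
  integral_mem_Icc G ((measurable_reward w).comp measurable_subtype_coe)
    fun x => reward_mem w hw x x.2

theorem meanCost_mem {w : ℝ} (hw : 0 ≤ w) : meanCost G w ∈ Set.Icc 0 w :=
  integral_mem_Icc G ((measurable_cost w).comp measurable_subtype_coe)
    fun x => cost_mem w hw x x.2

theorem abs_cost_sub_le (hv : ∀ t, v t ∈ Set.Icc 0 vmax) {p : ℕ → ℝ}
    (hp : ∀ t, p t ∈ Set.Icc 0 vmax) (s : ℕ) : |cost (v s) (p s) - meanCost G (v s)| ≤ vmax := by
  have h1 := cost_mem (v s) (hv s).1 (p s) (hp s)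
  have h2 := meanCost_mem G (hv s).1
  exact (abs_sub_le_of_nonneg_of_le h1.1 h1.2 h2.1 h2.2).trans (hv s).2

/-- Martingale increments are orthogonal: the cross term is a function of earlier bids times a
centred function of the current bid. -/
theorem integral_costNoise_sq_le (hvm : 0 ≤ vmax) (hv : ∀ t, v t ∈ Set.Icc 0 vmax) {t : ℕ}
    (ht : t ≤ T) :
    ∫ p, costNoise vmax ρ T v (rounds p) (fun s => meanCost G (v s)) t ^ 2 ∂(bidLaw G T) ≤
      t * vmax ^ 2 := by
  set cbar := fun s => meanCost G (v s) with hcbar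
  have hc : ∀ (p : Fin T → Set.Icc (0 : ℝ) vmax) s,
      |cost (v s) (rounds p s) - cbar s| ≤ vmax := fun p s =>
    abs_cost_sub_le G hv (rounds_mem hvm p) s
  induction t with
  | zero => simp [costNoise]
  | succ t ih =>
    have ih' := ih (by omega)
    have hM := measurable_costNoise (vmax := vmax) (ρ := ρ) (T := T) (v := v) cbar t
    have hx := measurable_decision (measurable_rounds (vmax := vmax) (T := T)) vmax ρ T v (t + 1)
    have hcm : Measurable fun y => cost (v (t + 1)) y - cbar (t + 1) :=
      (measurable_cost _).sub_const _
    have hy : Measurable fun p : Fin T → Set.Icc (0 : ℝ) vmax =>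
        decision vmax ρ T v (rounds p) (t + 1) *
          (cost (v (t + 1)) (rounds p (t + 1)) - cbar (t + 1)) :=
      hx.mul (hcm.comp (measurable_rounds _))
    have hMb : ∀ p : Fin T → Set.Icc (0 : ℝ) vmax,
        |costNoise vmax ρ T v (rounds p) cbar t| ≤ t * vmax := fun p => abs_costNoise_le (hc p) t
    have hyb : ∀ p : Fin T → Set.Icc (0 : ℝ) vmax, |decision vmax ρ T v (rounds p) (t + 1) *
          (cost (v (t + 1)) (rounds p (t + 1)) - cbar (t + 1))| ≤ vmax := fun p =>
      abs_decision_mul_le (hc p _)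
    have hdep : DependsOn (fun p : Fin T → Set.Icc (0 : ℝ) vmax =>
        costNoise vmax ρ T v (rounds p) cbar t * decision vmax ρ T v (rounds p) (t + 1))
        {⟨t, ht⟩}ᶜ := fun p p' h => by
      have h2 := dependsOn_decision (ρ := ρ) (v := v) ⟨t, ht⟩ h
      simp only at h2
      simp only [h2, costNoise]
      congr 1
      refine Finset.sum_congr rfl fun s hs => ?_
      have h3 := rounds_congr h
      rw [decision_congr fun τ hτ => h3 τ ?_, h3 s hs]
      simp only [Finset.mem_Icc] at hs hτ ⊢
      omega
    have h1 := integral_mul_rounds G ht (hM.mul hx) hdep hcm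
    have h2 : ∫ x : Set.Icc (0 : ℝ) vmax, (cost (v (t + 1)) x - cbar (t + 1)) ∂G = 0 := by
      rw [integral_sub _ (integrable_const _), integral_const, hcbar]
      · simp [meanCost]
      · refine integrable_of_abs_le ((measurable_cost _).comp measurable_subtype_coe) vmax
          fun x => ?_
        have := cost_mem (v (t + 1)) (hv _).1 x x.2
        rw [abs_of_nonneg this.1]
        exact this.2.trans (hv _).2
    rw [h2, mul_zero] at h1
    have hi1 : Integrable (fun p => costNoise vmax ρ T v (rounds p) cbar t ^ 2) (bidLaw G T) :=
      integrable_of_abs_le (hM.pow_const 2) ((t * vmax) ^ 2) fun p => by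
        rw [abs_pow]; exact pow_le_pow_left₀ (abs_nonneg _) (hMb p) 2
    have hi2 : Integrable (fun p => costNoise vmax ρ T v (rounds p) cbar t *
        decision vmax ρ T v (rounds p) (t + 1) *
          (cost (v (t + 1)) (rounds p (t + 1)) - cbar (t + 1))) (bidLaw G T) :=
      integrable_of_abs_le ((hM.mul hx).mul (hcm.comp (measurable_rounds _))) (t * vmax * vmax)
        fun p => by
          rw [mul_assoc, abs_mul]
          exact mul_le_mul (hMb p) (hyb p) (abs_nonneg _) (by positivity)
    have hi3 : Integrable (fun p => (decision vmax ρ T v (rounds p) (t + 1) *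
          (cost (v (t + 1)) (rounds p (t + 1)) - cbar (t + 1))) ^ 2) (bidLaw G T) :=
      integrable_of_abs_le (hy.pow_const 2) (vmax ^ 2) fun p => by
        rw [abs_pow]; exact pow_le_pow_left₀ (abs_nonneg _) (hyb p) 2
    have h3 : ∫ p, (decision vmax ρ T v (rounds p) (t + 1) *
          (cost (v (t + 1)) (rounds p (t + 1)) - cbar (t + 1))) ^ 2 ∂(bidLaw G T) ≤ vmax ^ 2 := by
      have := integral_mono hi3 (integrable_const (vmax ^ 2)) fun p => by
        simp only
        rw [← sq_abs]; exact pow_le_pow_left₀ (abs_nonneg _) (hyb p) 2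
      simpa using this
    have h4 : ∀ p : Fin T → Set.Icc (0 : ℝ) vmax,
        costNoise vmax ρ T v (rounds p) cbar (t + 1) ^ 2 =
          costNoise vmax ρ T v (rounds p) cbar t ^ 2 +
          2 * (costNoise vmax ρ T v (rounds p) cbar t * decision vmax ρ T v (rounds p) (t + 1) *
            (cost (v (t + 1)) (rounds p (t + 1)) - cbar (t + 1))) +
          (decision vmax ρ T v (rounds p) (t + 1) *
            (cost (v (t + 1)) (rounds p (t + 1)) - cbar (t + 1))) ^ 2 := fun p => by
      rw [costNoise, Finset.sum_Icc_succ_top (by omega), ← costNoise]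
      ring
    simp only [h4]
    refine (integral_add (hi1.add (hi2.const_mul 2)) hi3).le.trans ?_
    rw [integral_add' hi1 (hi2.const_mul 2), integral_const_mul]
    simp only [Pi.mul_apply] at h1
    rw [h1]
    push_cast
    linarith

theorem integral_abs_costNoise_le (hvm : 0 < vmax) (hv : ∀ t, v t ∈ Set.Icc 0 vmax)
    (hT : 1 ≤ T) :
    ∫ p, |costNoise vmax ρ T v (rounds p) (fun s => meanCost G (v s)) T| ∂(bidLaw G T) ≤
      vmax * √T := by
  have hT0 : 0 < √(T : ℝ) := Real.sqrt_pos.2 (by exact_mod_cast hT)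
  have hTs : √(T : ℝ) ^ 2 = T := Real.sq_sqrt (Nat.cast_nonneg T)
  set cbar := fun s => meanCost G (v s) with hcbar
  have hM := measurable_costNoise (vmax := vmax) (ρ := ρ) (T := T) (v := v) cbar T
  have hMb : ∀ p : Fin T → Set.Icc (0 : ℝ) vmax,
      |costNoise vmax ρ T v (rounds p) cbar T| ≤ T * vmax := fun p =>
    abs_costNoise_le (abs_cost_sub_le G hv (rounds_mem hvm.le p)) T
  have hi1 : Integrable (fun p => |costNoise vmax ρ T v (rounds p) cbar T|) (bidLaw G T) :=
    (integrable_of_abs_le hM _ hMb).abs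
  have hi2 : Integrable (fun p => costNoise vmax ρ T v (rounds p) cbar T ^ 2) (bidLaw G T) :=
    integrable_of_abs_le (hM.pow_const 2) ((T * vmax) ^ 2) fun p => by
      rw [abs_pow]; exact pow_le_pow_left₀ (abs_nonneg _) (hMb p) 2
  have h2 := integral_costNoise_sq_le (ρ := ρ) G hvm.le hv (le_refl T)
  set a := vmax * √(T : ℝ) with ha
  have ha0 : 0 < a := by positivity
  have ha2 : a ^ 2 = T * vmax ^ 2 := by rw [ha, mul_pow, hTs]; ring
  rw [← ha2] at h2
  -- Passes from the second moment to the first; `a` is the bound on the standard deviation.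
  have h3 : ∀ x : ℝ, 2 * a * |x| ≤ x ^ 2 + a ^ 2 := fun x => by
    have := two_mul_le_add_sq a |x|
    rw [sq_abs] at this
    linarith
  have h4 := integral_mono (hi1.const_mul (2 * a)) (hi2.add (integrable_const (a ^ 2)))
    fun p => h3 (costNoise vmax ρ T v (rounds p) cbar T)
  simp only [Pi.add_apply] at h4
  rw [integral_const_mul, integral_add hi2 (integrable_const _), integral_const, probReal_univ,
    one_smul] at h4
  have h5 : 2 * a * ∫ p, |costNoise vmax ρ T v (rounds p) cbar T| ∂(bidLaw G T) ≤ 2 * a * a := by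
    linarith
  exact le_of_mul_le_mul_left h5 (by positivity)

theorem roundExcess_le (hv : ∀ t, v t ∈ Set.Icc 0 vmax) {p : ℕ → ℝ}
    (hp : ∀ t, p t ∈ Set.Icc 0 vmax) (t : ℕ) :
    roundExcess vmax ρ T v p (fun s => meanReward G (v s)) (fun s => meanCost G (v s)) t ≤
      3 * vmax := by
  have h1 := excess_le (T := T) (s := stateAfter vmax ρ T v p (t - 1)) (f := reward (v t))
    (hv t).1 (fun i => reward_mem (v t) (hv t).1 _ (hp i)) (meanReward_mem G (hv t).1)
  have h2 := excess_le (T := T) (s := stateAfter vmax ρ T v p (t - 1)) (f := cost (v t))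
    (hv t).1 (fun i => cost_mem (v t) (hv t).1 _ (hp i)) (meanCost_mem G (hv t).1)
  have := (hv t).2
  unfold roundExcess
  linarith

theorem integrable_roundExcess (hvm : 0 ≤ vmax) (hv : ∀ t, v t ∈ Set.Icc 0 vmax) (t : ℕ) :
    Integrable (fun p => roundExcess vmax ρ T v (rounds p) (fun s => meanReward G (v s))
      (fun s => meanCost G (v s)) t) (bidLaw G T) :=
  integrable_of_abs_le (measurable_roundExcess measurable_rounds ..) (3 * vmax) fun p => by
    rw [abs_of_nonneg (roundExcess_nonneg ..)]
    exact roundExcess_le G hv (rounds_mem hvm p) t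

theorem integral_roundExcess_le (hvm : 0 ≤ vmax) (hv : ∀ t, v t ∈ Set.Icc 0 vmax) {t : ℕ}
    (ht : t + 1 ≤ T) :
    ∫ p, roundExcess vmax ρ T v (rounds p) (fun s => meanReward G (v s))
      (fun s => meanCost G (v s)) (t + 2) ∂(bidLaw G T) ≤ 3 * vmax / T := by
  have hw := hv (t + 2)
  have h1 := integral_excess_le (ρ := ρ) (v := v) G hvm hw.1 (measurable_reward (v (t + 2)))
    (reward_mem _ hw.1) ht
  have h2 := integral_excess_le (ρ := ρ) (v := v) G hvm hw.1 (measurable_cost (v (t + 2)))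
    (cost_mem _ hw.1) ht
  have hs := measurableState_stateAfter (measurable_rounds (vmax := vmax) (T := T))
    vmax ρ T v (t + 1)
  have hi1 : Integrable (fun p => excess T (rounds p) (stateAfter vmax ρ T v (rounds p) (t + 1))
      (reward (v (t + 2))) (v (t + 2)) (meanReward G (v (t + 2)))) (bidLaw G T) :=
    integrable_of_abs_le (hs.excess measurable_rounds T (measurable_reward _) _ _) (v (t + 2))
      fun p => by
        rw [abs_of_nonneg (excess_nonneg ..)]
        exact excess_le hw.1 (fun i => reward_mem _ hw.1 _ (rounds_mem hvm p i))
          (meanReward_mem G hw.1)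
  have hi2 : Integrable (fun p => excess T (rounds p) (stateAfter vmax ρ T v (rounds p) (t + 1))
      (cost (v (t + 2))) (v (t + 2)) (meanCost G (v (t + 2)))) (bidLaw G T) :=
    integrable_of_abs_le (hs.excess measurable_rounds T (measurable_cost _) _ _) (v (t + 2))
      fun p => by
        rw [abs_of_nonneg (excess_nonneg ..)]
        exact excess_le hw.1 (fun i => cost_mem _ hw.1 _ (rounds_mem hvm p i))
          (meanCost_mem G hw.1)
  have h3 : v (t + 2) / T ≤ vmax / T := div_le_div_of_nonneg_right hw.2 (Nat.cast_nonneg T)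
  unfold roundExcess
  rw [show t + 2 - 1 = t + 1 from rfl, integral_add (hi1.const_mul 2) hi2, integral_const_mul]
  unfold meanReward meanCost
  rw [mul_div_assoc]
  linarith

/-- Round `1` has no observations and is bounded trivially by `3 * vmax`; the later rounds
contribute at most `3 * vmax / T` each. -/
theorem integral_sum_roundExcess_le (hvm : 0 ≤ vmax) (hv : ∀ t, v t ∈ Set.Icc 0 vmax)
    (hT : 1 ≤ T) :
    ∫ p, ∑ t ∈ Finset.Icc 1 T, roundExcess vmax ρ T v (rounds p) (fun s => meanReward G (v s))
      (fun s => meanCost G (v s)) t ∂(bidLaw G T) ≤ 6 * vmax := by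
  have hi := integrable_roundExcess (ρ := ρ) (T := T) G hvm hv
  have hT0 : (0 : ℝ) < T := by exact_mod_cast hT
  rw [integral_finsetSum _ fun t _ => hi t, ← Finset.add_sum_Ioc_eq_sum_Icc hT]
  have h1 := integral_mono (hi 1) (integrable_const (3 * vmax)) fun p =>
    roundExcess_le G hv (rounds_mem hvm p) 1
  rw [integral_const, probReal_univ, one_smul] at h1
  have h2 : ∀ t ∈ Finset.Ioc 1 T, ∫ p, roundExcess vmax ρ T v (rounds p)
      (fun s => meanReward G (v s)) (fun s => meanCost G (v s)) t ∂(bidLaw G T) ≤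
        3 * vmax / T := fun t ht => by
    rw [Finset.mem_Ioc] at ht
    obtain ⟨k, rfl⟩ : ∃ k, t = k + 2 := ⟨t - 2, by omega⟩
    exact integral_roundExcess_le G hvm hv (by omega)
  have h3 := Finset.sum_le_card_nsmul _ _ _ h2
  have h4 : (Finset.Ioc 1 T).card • (3 * vmax / T) ≤ 3 * vmax := by
    rw [nsmul_eq_mul, Nat.card_Ioc]
    calc ((T - 1 : ℕ) : ℝ) * (3 * vmax / T) ≤ T * (3 * vmax / T) := by
          gcongr; omega
      _ = 3 * vmax := by field_simp
  linarith

theorem integrable_decision_mul (t : ℕ) {g : ℝ → ℝ} (hg : Measurable g) {C : ℝ}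
    (hC : ∀ p : Fin T → Set.Icc (0 : ℝ) vmax, |g (rounds p t)| ≤ C) :
    Integrable (fun p => decision vmax ρ T v (rounds p) t * g (rounds p t)) (bidLaw G T) :=
  integrable_of_abs_le ((measurable_decision measurable_rounds ..).mul
    (hg.comp (measurable_rounds t))) C fun p => abs_decision_mul_le (hC p)

theorem abs_reward_le (hvm : 0 ≤ vmax) (hv : ∀ t, v t ∈ Set.Icc 0 vmax) (t s : ℕ)
    (p : Fin T → Set.Icc (0 : ℝ) vmax) : |reward (v t) (rounds p s)| ≤ vmax := by
  have h := reward_mem (v t) (hv t).1 _ (rounds_mem hvm p s)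
  rw [abs_of_nonneg h.1]
  exact h.2.trans (hv t).2

theorem integrable_algRevenue (hvm : 0 ≤ vmax) (hv : ∀ t, v t ∈ Set.Icc 0 vmax) :
    Integrable (fun p => algRevenue vmax ρ T v (rounds p)) (bidLaw G T) :=
  integrable_finsetSum _ fun t _ =>
    integrable_decision_mul G t (measurable_reward (v t)) (abs_reward_le hvm hv t t)

theorem integrable_reward (hvm : 0 ≤ vmax) (hv : ∀ t, v t ∈ Set.Icc 0 vmax) (t : ℕ) :
    Integrable (fun p => reward (v t) (rounds p t)) (bidLaw G T) :=
  integrable_of_abs_le ((measurable_reward _).comp (measurable_rounds t)) vmax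
    (abs_reward_le hvm hv t t)

theorem integrable_hindsight (hρ : 0 ≤ ρ) (hvm : 0 ≤ vmax) (hv : ∀ t, v t ∈ Set.Icc 0 vmax) :
    Integrable (fun p => hindsight ρ T v (rounds p)) (bidLaw G T) :=
  Integrable.mono' (integrable_finsetSum (Finset.Icc 1 T) fun t _ => integrable_reward G hvm hv t)
    (measurable_hindsight hρ measurable_rounds T v).aestronglyMeasurable
    (Eventually.of_forall fun p => by
      rw [Real.norm_eq_abs, abs_of_nonneg (hindsight_nonneg hρ ..)]
      exact hindsight_le hρ ..)

theorem integral_hindsight_le (hρ : 0 ≤ ρ) (hvm : 0 ≤ vmax) (hv : ∀ t, v t ∈ Set.Icc 0 vmax) :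
    ∫ p, hindsight ρ T v (rounds p) ∂(bidLaw G T) ≤
      ∑ t ∈ Finset.Icc 1 T, meanReward G (v t) := by
  have hi := integrable_reward (T := T) G hvm hv
  refine (integral_mono (integrable_hindsight G hρ hvm hv)
    (integrable_finsetSum (Finset.Icc 1 T) fun t _ => hi t) fun p => hindsight_le hρ ..).trans ?_
  rw [integral_finsetSum _ fun t _ => hi t]
  refine Finset.sum_le_sum fun t ht => ?_
  rw [Finset.mem_Icc] at ht
  obtain ⟨k, rfl⟩ : ∃ k, t = k + 1 := ⟨t - 1, by omega⟩
  have := integral_mul_rounds G (show k < T by omega) (measurable_const (a := (1 : ℝ)))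
    (fun _ _ _ => rfl) (measurable_reward (v (k + 1)))
  simp only [one_mul, integral_const, probReal_univ, one_smul] at this
  rw [this, meanReward]

/-- The decision in a round is independent of the bid in that round, so the realised revenue may be
replaced by its mean. -/
theorem integral_algRevenue (hvm : 0 ≤ vmax) (hv : ∀ t, v t ∈ Set.Icc 0 vmax) :
    ∫ p, algRevenue vmax ρ T v (rounds p) ∂(bidLaw G T) =
      ∫ p, ∑ t ∈ Finset.Icc 1 T, decision vmax ρ T v (rounds p) t * meanReward G (v t)
        ∂(bidLaw G T) := by
  have hi : ∀ t, Integrable (fun p => decision vmax ρ T v (rounds p) t *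
      reward (v t) (rounds p t)) (bidLaw G T) := fun t =>
    integrable_decision_mul G t (measurable_reward (v t)) (abs_reward_le hvm hv t t)
  have h1 : ∀ p : Fin T → Set.Icc (0 : ℝ) vmax, algRevenue vmax ρ T v (rounds p) =
    ∑ t ∈ Finset.Icc 1 T, decision vmax ρ T v (rounds p) t * reward (v t) (rounds p t) :=
    fun _ => rfl
  simp only [h1]
  rw [integral_finsetSum _ fun t _ => hi t, integral_finsetSum _ fun t _ =>
    integrable_decision_mul G t (measurable_const (a := meanReward G (v t))) fun _ => le_rfl]
  refine Finset.sum_congr rfl fun t ht => ?_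
  rw [Finset.mem_Icc] at ht
  obtain ⟨k, rfl⟩ : ∃ k, t = k + 1 := ⟨t - 1, by omega⟩
  rw [integral_mul_rounds G (show k < T by omega) (measurable_decision measurable_rounds ..)
    (dependsOn_decision ⟨k, by omega⟩) (measurable_reward _), integral_mul_const, meanReward]

/-- The revenue of OGD-CB falls short of `ρ / vmax` times the benchmark by `O(√T log T)`. -/
theorem competitive_bound (hρ : 0 < ρ) (hρv : ρ ≤ vmax) (hv : ∀ t, v t ∈ Set.Icc 0 vmax)
    (hT : 1 ≤ T) :
    -((7 * vmax + regretConst vmax ρ) * (1 + radiusSq T) * √T) ≤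
      ∫ p, (algRevenue vmax ρ T v (rounds p) - ρ / vmax * hindsight ρ T v (rounds p))
        ∂(bidLaw G T) := by
  have hvm : 0 < vmax := hρ.trans_le hρv
  have hα : 0 ≤ ρ / vmax := by positivity
  have hE := integrable_roundExcess (ρ := ρ) (T := T) G hvm.le hv
  have hD : Integrable (fun p => ∑ t ∈ Finset.Icc 1 T,
      decision vmax ρ T v (rounds p) t * meanReward G (v t)) (bidLaw G T) :=
    integrable_finsetSum _ fun t _ =>
      integrable_decision_mul G t (measurable_const (a := meanReward G (v t))) fun _ => le_rfl
  have hN : Integrable (fun p => |costNoise vmax ρ T v (rounds p) (fun s => meanCost G (v s)) T|)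
      (bidLaw G T) :=
    (integrable_of_abs_le (measurable_costNoise _ T) _ fun p =>
      abs_costNoise_le (abs_cost_sub_le G hv (rounds_mem hvm.le p)) T).abs
  have hpath := integral_mono (integrable_const _)
    (((hD.add hN).add (integrable_finsetSum (Finset.Icc 1 T) fun t _ => hE t)).add
      (integrable_const (regretConst vmax ρ * (1 + radiusSq T) * √T)))
    fun p => pathwise_revenue (T := T) (p := rounds p) hρ hρv hv
      (fun t => (rounds_mem hvm.le p t).1) (fun t => meanReward_mem G (hv t).1)
      (fun t => meanCost_mem G (hv t).1) hT
  rw [integral_add' ((hD.add hN).add (integrable_finsetSum _ fun t _ => hE t))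
    (integrable_const _), integral_add' (hD.add hN) (integrable_finsetSum _ fun t _ => hE t),
    integral_add' hD hN, ← integral_algRevenue G hvm.le hv] at hpath
  simp only [integral_const, probReal_univ, one_smul] at hpath
  have h1 := integral_abs_costNoise_le (ρ := ρ) G hvm hv hT
  have h2 := integral_sum_roundExcess_le (ρ := ρ) G hvm.le hv hT
  have h3 := mul_le_mul_of_nonneg_left (integral_hindsight_le (T := T) G hρ.le hvm.le hv) hα
  rw [integral_sub (integrable_algRevenue G hvm.le hv)
    ((integrable_hindsight G hρ.le hvm.le hv).const_mul _), integral_const_mul]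
  have hT1 : 1 ≤ √(T : ℝ) := Real.one_le_sqrt.2 (by exact_mod_cast hT)
  -- The `7` is `6` from the estimation errors and `1` from the cost noise.
  have h4 : vmax ≤ vmax * √(T : ℝ) := le_mul_of_one_le_right hvm.le hT1
  have h5 : 0 ≤ vmax * (radiusSq T * √(T : ℝ)) := by
    have := radiusSq_nonneg T
    positivity
  linarith

end Expectation

/-! ### The limit of the average regret. -/

theorem tendsto_regret_rate (C : ℝ) :
    Tendsto (fun T : ℕ => 1 / (T : ℝ) * -(C * (1 + radiusSq T) * √T)) atTop (nhds 0) := by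
  have hsqrt : Tendsto (fun T : ℕ => (√(T : ℝ))⁻¹) atTop (nhds 0) :=
    tendsto_inv_atTop_zero.comp (Real.tendsto_sqrt_atTop.comp tendsto_natCast_atTop_atTop)
  have hlog : Tendsto (fun T : ℕ => Real.log T / √(T : ℝ)) atTop (nhds 0) := by
    have h := (isLittleO_log_rpow_atTop (by norm_num : (0 : ℝ) < 1 / 2)).tendsto_div_nhds_zero
    have h' := h.comp tendsto_natCast_atTop_atTop
    refine h'.congr fun T => ?_
    simp [Real.sqrt_eq_rpow]
  have h := ((hsqrt.const_mul (1 + Real.log 2 / 2)).add hlog).const_mul (-C)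
  simp only [mul_zero, add_zero] at h
  refine h.congr fun T => ?_
  rcases Nat.eq_zero_or_pos T with rfl | hT
  · simp
  have h0 : (0 : ℝ) < T := by exact_mod_cast hT
  have h1 : 0 < √(T : ℝ) := Real.sqrt_pos.2 h0
  have h2 : (T : ℝ) = √(T : ℝ) ^ 2 := (Real.sq_sqrt h0.le).symm
  have h3 : 1 / (T : ℝ) * √(T : ℝ) = (√(T : ℝ))⁻¹ := by
    rw [one_div, ← div_eq_inv_mul]
    exact Real.sqrt_div_self
  rw [radiusSq, div_eq_mul_inv (Real.log T), ← h3]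
  ring

end Throttling

theorem mainTheorem7 (vmax ρ : ℝ) (hρ : 0 < ρ) (hρv : ρ ≤ vmax) :
    (∀ (T : ℕ) (v : Fin T → Set.Icc (0 : ℝ) vmax) (G : ProbabilityMeasure (Set.Icc (0 : ℝ) vmax)),
      Integrable (fun p : Fin T → Set.Icc (0 : ℝ) vmax =>
          Throttling.algRevenue vmax ρ T (Throttling.rounds v) (Throttling.rounds p))
        (Measure.pi fun _ : Fin T => (G : Measure (Set.Icc (0 : ℝ) vmax))) ∧
      Integrable (fun p : Fin T → Set.Icc (0 : ℝ) vmax =>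
          Throttling.hindsight ρ T (Throttling.rounds v) (Throttling.rounds p))
        (Measure.pi fun _ : Fin T => (G : Measure (Set.Icc (0 : ℝ) vmax)))) ∧
    (0 : EReal) ≤ liminf (fun T : ℕ =>
      ⨅ (v : Fin T → Set.Icc (0 : ℝ) vmax) (G : ProbabilityMeasure (Set.Icc (0 : ℝ) vmax)),
        (((1 / (T : ℝ)) * ∫ p : Fin T → Set.Icc (0 : ℝ) vmax,
            (Throttling.algRevenue vmax ρ T (Throttling.rounds v) (Throttling.rounds p)
              - ρ / vmax * Throttling.hindsight ρ T (Throttling.rounds v) (Throttling.rounds p))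
            ∂(Measure.pi fun _ : Fin T => (G : Measure (Set.Icc (0 : ℝ) vmax))) : ℝ) : EReal))
      atTop := by
  have hvm : 0 < vmax := hρ.trans_le hρv
  refine ⟨fun T v G => ⟨?_, ?_⟩, ?_⟩
  · exact Throttling.integrable_algRevenue _ hvm.le (Throttling.rounds_mem hvm.le v)
  · exact Throttling.integrable_hindsight _ hρ.le hvm.le (Throttling.rounds_mem hvm.le v)
  have hlim := Throttling.tendsto_regret_rate (7 * vmax + Throttling.regretConst vmax ρ)
  have hlim' := (continuous_coe_real_ereal.tendsto 0).comp hlim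
  -- Zero is rewritten as the lower limit of the uniform regret bound, so that it suffices to
  -- compare the two sequences for each `T ≥ 1`.
  rw [← EReal.coe_zero, ← hlim'.liminf_eq]
  refine liminf_le_liminf ?_
  filter_upwards [eventually_ge_atTop 1] with T hT
  refine le_iInf fun v => le_iInf fun G => ?_
  rw [Function.comp_apply, EReal.coe_le_coe_iff]
  exact mul_le_mul_of_nonneg_left
    (Throttling.competitive_bound (G : Measure (Set.Icc (0 : ℝ) vmax)) hρ hρv
      (Throttling.rounds_mem hvm.le v) hT) (by positivity)
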